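/- Let $\mathcal G$ be the belt buckle: the graph with two vertices joined by three edges $e_1,e_2,e_3$. Replace each edge $e$ by two opposite directed edges $e,\bar e$, let $A$ be the $6\times 6$ $0$-$1$ matrix with $A(d,d')=1$ iff $d'$ begins where $d$ ends and $d'\neq\bar d$, and let $\Sigma_A^+$ be the one-sided subshift of finite type of $A$, with shift $\sigma$. A function $\varphi$ on the edges is regarded as the function $\underline e\mapsto \varphi(e_0)$ on $\Sigma_A^+$, where $e_0$ is the zeroth edge of $\underline e$. For an edge weighting $l:\{e_1,e_2,e_3\}\to\mathbb R_{>0}$ the entropy is $h(l)=\lim_{T\to\infty}\frac1T\log\#\{\gamma:\ l(\gamma)<T\}$, where $\gamma=(d_0,\dots,d_n=d_0)$, $n\ge 1$, runs over the closed cycles of directed edges with $A(d_i,d_{i+1})=1$ for all $0\le i<n$, and $l(\gamma)=\sum_{i<n}l(d_i)$. Let $\mathcal M^1_{\mathcal G}=\{l>0:\ h(l)=1\}$. For $f\in C(\Sigma_A^+)$ let $(\mathcal L_fw)(\underline x)=\sum_{\sigma\underline y=\underline x}e^{f(\underline y)}w(\underline y)$, and let $P(f)$ be the logarithm of the spectral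 radius of $\mathcal L_f$ on the complex-valued continuous functions. For $l\in\mathcal M^1_{\mathcal G}$ one has $P(-l)=0$, and $m_{-l}$ denotes the equilibrium state of $-l$, i.e. the unique probability measure of the form $v\mu/\int v\,d\mu$ with $v>0$ continuous, $\mathcal L_{-l}v=v$, and $\mu$ a probability measure with $\mathcal L_{-l}^*\mu=\mu$. The tangent space at $l$ consists of the functions $\varphi$ on $\Sigma_A^+$ that depend only on the zeroth directed edge and satisfy $\int\varphi\,dm_{-l}=0$, and the pressure metric on it is $$\|\varphi\|_P^2=\mathrm{Var}(\varphi,m_{-l})=\lim_{n\to\infty}\frac1n\int\Big(\sum_{i<n}\varphi\circ\sigma^i-n\int\varphi\,dm_{-l}\Big)^2dm_{-l}.$$ Put $A_{-l}(i,j)=A(i,j)e^{-l(i)}$, let $\mathbf v>0$ satisfy $\mathbf vA_{-l}=\mathbf v$, put $P_{-l}(i,j)=A(i,j)\mathbf v(i)e^{-l(i)}/\mathbf v(j)$, and let $\mathbf p$ be the unique vector with $P_{-l}\mathbf p=\mathbf p$ and $\sum_i\mathbf p(i)=1$; $\mathbf p_3$ is its entry at the directed edge $e_3$. Let $S(x,y)=-\log\frac{e^{x+y}-1}{e^x+e^y+2}$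 and $l(x,y)=(x,y,S(x,y))$. **Proposition.** The map $(x,y)\mapsto l(x,y)$ is a bijection from $\{(x,y):\ x>0,\ y>0,\ e^{x+y}<3+e^x+e^y\}$ onto $\mathcal M^1_{\mathcal G}$. At each such $(x,y)$ the measure $m_{-l}$ and the vector $\mathbf p$ exist and are unique, $\frac{\partial l}{\partial x}$ and $\frac{\partial l}{\partial y}$ are tangent vectors at $l=l(x,y)$, and the first fundamental form of $(\mathcal M^1_{\mathcal G},\|\cdot\|_P)$ in the coordinates $(x,y)$ is given by $$\begin{aligned} E_P&=\mathrm{Var}\Big(\frac{\partial l}{\partial x},m_{-l}\Big)=2\,\frac{\partial^2S}{\partial x^2}\,\mathbf p_3=\frac{e^x(e^y+1)^2(e^{2x+y}+e^y+2)}{2(e^x+e^y+2)(e^{x+y}-1)(3e^{x+y}+e^{2x+y}+e^{x+2y}-1)},\\ F_P&=\frac12\Big(\mathrm{Var}\Big(\frac{\partial l}{\partial x}+\frac{\partial l}{\partial y},m_{-l}\Big)-\mathrm{Var}\Big(\frac{\partial l}{\partial x},m_{-l}\Big)-\mathrm{Var}\Big(\frac{\partial l}{\partial y},m_{-l}\Big)\Big)=2\,\frac{\partial^2S}{\partial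 x\partial y}\,\mathbf p_3\\ &=\frac{(e^x+1)(e^y+1)e^{x+y}(-e^{x+y}+e^x+e^y+3)}{2(e^x+e^y+2)(e^{x+y}-1)(3e^{x+y}+e^{2x+y}+e^{x+2y}-1)},\\ G_P&=\mathrm{Var}\Big(\frac{\partial l}{\partial y},m_{-l}\Big)=2\,\frac{\partial^2S}{\partial y^2}\,\mathbf p_3=\frac{(e^x+1)^2e^y(e^{x+2y}+e^x+2)}{2(e^x+e^y+2)(e^{x+y}-1)(3e^{x+y}+e^{2x+y}+e^{x+2y}-1)}; \end{aligned}$$ that is, $\big\|a\frac{\partial l}{\partial x}+b\frac{\partial l}{\partial y}\big\|_P^2=a^2E_P+2ab\,F_P+b^2G_P$ for all $a,b\in\mathbb R$, all the variances existing as limits. -/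

import Mathlib

open Filter Topology MeasureTheory

noncomputable section

/-! ## One-sided subshifts of finite type -/

/-- The one-sided subshift of finite type `Σ_A⁺` of a 0-1 matrix `A`. -/
def Subshift {ι : Type*} (A : Matrix ι ι ℕ) : Type _ :=
  {x : ℕ → ι // ∀ n, A (x n) (x (n + 1)) = 1}

namespace Subshift

variable {ι : Type*} [Fintype ι] [TopologicalSpace ι] [DiscreteTopology ι]
  {A : Matrix ι ι ℕ}

/-- The subspace topology of the product topology (the alphabet being discrete). -/
instance : TopologicalSpace (Subshift A) :=
  inferInstanceAs (TopologicalSpace {x : ℕ → ι // ∀ n, A (x n) (x (n + 1)) = 1})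

instance : MeasurableSpace (Subshift A) := borel _

instance : BorelSpace (Subshift A) := ⟨rfl⟩

instance : T2Space (Subshift A) :=
  inferInstanceAs (T2Space {x : ℕ → ι // ∀ n, A (x n) (x (n + 1)) = 1})

instance : CompactSpace (Subshift A) := by
  have hc : IsClosed {x : ℕ → ι | ∀ n, A (x n) (x (n + 1)) = 1} := by
    rw [Set.ofPred_forall]
    refine isClosed_iInter fun n => ?_
    have h : Continuous fun x : ℕ → ι => (x n, x (n + 1)) := by fun_prop
    exact (isClosed_discrete {q : ι × ι | A q.1 q.2 = 1}).preimage h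
  exact isCompact_iff_compactSpace.mp hc.isCompact

/-- The letter at place `n`. -/
def coord (n : ℕ) (x : Subshift A) : ι := x.1 n

/-- The shift map, `(σ x)ₙ = xₙ₊₁`. -/
def shift (x : Subshift A) : Subshift A := ⟨fun n => x.1 (n + 1), fun n => x.2 (n + 1)⟩

/-- The sequence `i x₀ x₁ x₂ …`, admissible when `A(i, x₀) = 1`. -/
def cons (i : ι) (x : Subshift A) (h : A i (coord 0 x) = 1) : Subshift A :=
  ⟨fun n => Nat.casesOn n i x.1, fun n => by cases n with
    | zero => exact h
    | succ k => exact x.2 k⟩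

end Subshift

namespace Subshift

/-- The points `cons i x` are exactly the preimages of `x` under the shift. -/
theorem shift_eq_iff {ι : Type*} {A : Matrix ι ι ℕ} (x y : Subshift A) :
    shift y = x ↔ ∃ (i : ι) (h : A i (coord 0 x) = 1), y = cons i x h := by
  constructor
  · rintro rfl
    refine ⟨y.1 0, y.2 0, Subtype.ext (funext fun n => ?_)⟩
    cases n <;> rfl
  · rintro ⟨i, h, rfl⟩
    rfl

theorem continuous_coord {ι : Type*} [TopologicalSpace ι] {A : Matrix ι ι ℕ} (n : ℕ) :
    Continuous (coord n : Subshift A → ι) :=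
  (continuous_apply n).comp continuous_subtype_val

variable {ι : Type*} [Fintype ι] [TopologicalSpace ι] [DiscreteTopology ι]
  {A : Matrix ι ι ℕ}

/-- The transfer operator `(L_f w)(x) = ∑_{σ y = x} e^{f(y)} w(y)`, for functions with values in a
real vector space; the preimages of `x` are the points `cons i x`. -/
def transfer {F : Type*} [AddCommGroup F] [Module ℝ F] (f : Subshift A → ℝ)
    (w : Subshift A → F) (x : Subshift A) : F :=
  ∑ i, if h : A i (coord 0 x) = 1 then Real.exp (f (cons i x h)) • w (cons i x h) else 0

theorem continuous_transfer {F : Type*} [NormedAddCommGroup F] [NormedSpace ℝ F]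
    {f : Subshift A → ℝ} (hf : Continuous f) {w : Subshift A → F} (hw : Continuous w) :
    Continuous (transfer f w) := by
  refine continuous_finsetSum _ fun i _ => ?_
  have hU : IsClopen {x : Subshift A | A i (coord 0 x) = 1} :=
    (isClopen_discrete {j : ι | A i j = 1}).preimage (continuous_coord 0)
  have hcons : Continuous
      fun x : {x : Subshift A | A i (coord 0 x) = 1} => cons i x.1 x.2 := by
    refine Continuous.subtype_mk (continuous_pi fun n => ?_) _
    cases n with
    | zero => exact continuous_const
    | succ k => exact (continuous_coord k).comp continuous_subtype_val
  rw [← continuousOn_univ, ← Set.union_compl_self {x : Subshift A | A i (coord 0 x) = 1}]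
  refine ContinuousOn.union_of_isOpen ?_ ?_ hU.isOpen hU.compl.isOpen
  · rw [continuousOn_iff_continuous_domRestrict]
    refine (((Real.continuous_exp.comp (hf.comp hcons)).smul (hw.comp hcons))).congr fun x => ?_
    have hx : A i (coord 0 x.1) = 1 := x.2
    simp [hx]
  · refine (continuousOn_const (c := (0 : F))).congr fun x hx => ?_
    have hx' : ¬ A i (coord 0 x) = 1 := hx
    simp [hx']

/-- The transfer operator as a bounded operator on the Banach space `C(Σ_A⁺, ℂ)`. -/
def transferCLM (f : C(Subshift A, ℝ)) : C(Subshift A, ℂ) →L[ℂ] C(Subshift A, ℂ) :=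
  LinearMap.mkContinuous
    { toFun := fun w => ⟨transfer f w, continuous_transfer f.continuous w.continuous⟩
      map_add' := fun w w' => by
        ext x
        simp only [transfer, ContinuousMap.coe_mk, ContinuousMap.add_apply,
          ← Finset.sum_add_distrib]
        refine Finset.sum_congr rfl fun i _ => ?_
        split_ifs <;> simp
      map_smul' := fun c w => by
        ext x
        simp only [transfer, ContinuousMap.coe_mk, ContinuousMap.smul_apply, RingHom.id_apply,
          Finset.smul_sum]
        refine Finset.sum_congr rfl fun i _ => ?_
        split_ifs
        · exact smul_comm _ _ _
        · simp }
    (Fintype.card ι * Real.exp ‖f‖) (fun w => by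
      rw [ContinuousMap.norm_le _ (by positivity)]
      intro x
      calc ‖transfer f w x‖ ≤ ∑ _i : ι, Real.exp ‖f‖ * ‖w‖ := by
            refine norm_sum_le_of_le _ fun i _ => ?_
            split_ifs with h
            · rw [norm_smul, Real.norm_eq_abs, Real.abs_exp]
              gcongr
              · exact (Real.le_norm_self _).trans (f.norm_coe_le_norm _)
              · exact w.norm_coe_le_norm _
            · rw [norm_zero]; positivity
        _ = Fintype.card ι * Real.exp ‖f‖ * ‖w‖ := by
            simp [Finset.sum_const, nsmul_eq_mul, mul_assoc])

/-- The pressure `P(f)`: the logarithm of the spectral radius of the transfer operator. -/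
def pressure (f : C(Subshift A, ℝ)) : ℝ :=
  Real.log (spectralRadius ℂ (transferCLM f)).toReal

/-- `m` is an equilibrium state of `f`, where `P(f) = 0`: it is `v μ / ∫ v dμ` for a strictly
positive continuous eigenfunction `v` of `L_f` and a probability measure `μ` which is an
eigenvector of the dual of `L_f`, both for the eigenvalue `β_f = e^{P(f)}`. -/
def IsEquilibriumState (f : C(Subshift A, ℝ)) (m : Measure (Subshift A)) : Prop :=
  pressure f = 0 ∧
  ∃ (v : C(Subshift A, ℝ)) (μ : Measure (Subshift A)),
    (∀ x, 0 < v x) ∧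
    (∀ x, transfer f v x = Real.exp (pressure f) * v x) ∧
    IsProbabilityMeasure μ ∧
    (∀ φ : C(Subshift A, ℝ),
      ∫ x, transfer f φ x ∂μ = Real.exp (pressure f) * ∫ x, φ x ∂μ) ∧
    m = μ.withDensity fun x => ENNReal.ofReal (v x / ∫ z, v z ∂μ)

/-- `Var(w, μ) = V`, that is, `(1/n) ∫ (wⁿ - n ∫ w dμ)² dμ → V`, where `wⁿ` is the Birkhoff sum
`w + w ∘ σ + ⋯ + w ∘ σⁿ⁻¹`. -/
def HasVariance (w : Subshift A → ℝ) (μ : Measure (Subshift A)) (V : ℝ) : Prop :=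
  Tendsto (fun n : ℕ => (1 / (n : ℝ)) *
    ∫ x, (birkhoffSum shift w n x - n * ∫ z, w z ∂μ) ^ 2 ∂μ) atTop (𝓝 V)

end Subshift

/-! ## Metric graphs -/

/-- An undirected graph with vertex set `V` and edge set `E`, loops and multiple edges allowed.
The order in which the two endpoints of an edge are listed only serves to name its two
directions. -/
structure MultiGraph (V E : Type*) where
  endpt₀ : E → V
  endpt₁ : E → V

namespace MultiGraph

variable {V E : Type*}

/-- The directed edges: `(e, false)` is `e` run from `endpt₀ e` to `endpt₁ e`, and `(e, true)` is
the opposite directed edge. -/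
abbrev DirEdge (_G : MultiGraph V E) : Type _ := E × Bool

/-- The oppositely directed edge. -/
def opposite (G : MultiGraph V E) (d : G.DirEdge) : G.DirEdge := (d.1, !d.2)

/-- The vertex where a directed edge begins. -/
def origin (G : MultiGraph V E) (d : G.DirEdge) : V :=
  if d.2 then G.endpt₁ d.1 else G.endpt₀ d.1

/-- The vertex where a directed edge ends. -/
def terminus (G : MultiGraph V E) (d : G.DirEdge) : V :=
  if d.2 then G.endpt₀ d.1 else G.endpt₁ d.1

variable [DecidableEq V] [DecidableEq E]

/-- `A(d, d') = 1` if `d'` follows `d` and is not the opposite of `d`, and `0` otherwise. -/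
def adjMat (G : MultiGraph V E) : Matrix G.DirEdge G.DirEdge ℕ := fun d d' =>
  if G.origin d' = G.terminus d ∧ d' ≠ G.opposite d then 1 else 0

/-- The closed cycles `γ = (d₀, d₁, …, dₙ = d₀)`, `n ≥ 1`, of directed edges without
backtracking. -/
def IsClosedCycle (G : MultiGraph V E) (γ : List G.DirEdge) : Prop :=
  2 ≤ γ.length ∧ γ.IsChain (fun d d' => G.adjMat d d' = 1) ∧ γ.head? = γ.getLast?

/-- `l(γ) = l(d₀) + ⋯ + l(dₙ₋₁)` for `γ = (d₀, …, dₙ)`. -/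
def cycleLength (G : MultiGraph V E) (l : E → ℝ) (γ : List G.DirEdge) : ℝ :=
  (γ.dropLast.map fun d => l d.1).sum

/-- The metric graph `(G, l)` has entropy `h`:
`(1/T) log #{γ closed cycle; l(γ) < T} → h` as `T → ∞`. -/
def HasEntropy (G : MultiGraph V E) (l : E → ℝ) (h : ℝ) : Prop :=
  Tendsto (fun T : ℝ => (1 / T) *
    Real.log ({γ | G.IsClosedCycle γ ∧ G.cycleLength l γ < T}.ncard : ℝ)) atTop (𝓝 h)

/-- The moduli space of edge weightings `l : E → ℝ_{>0}` of entropy one. -/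
def moduliOne (G : MultiGraph V E) : Set (E → ℝ) :=
  {l | (∀ e, 0 < l e) ∧ G.HasEntropy l 1}

variable [Fintype E] [TopologicalSpace E] [DiscreteTopology E]

/-- A function on the edges as a locally constant function on `Σ_A⁺`, depending only on the
zeroth edge of a path. -/
def edgeFun (G : MultiGraph V E) (φ : E → ℝ) : C(Subshift G.adjMat, ℝ) :=
  ⟨fun x => φ (Subshift.coord 0 x).1,
    (continuous_of_discreteTopology (f := fun d : G.DirEdge => φ d.1)).comp
      (Subshift.continuous_coord 0)⟩

/-- The space of functions on `Σ_A⁺` which depend only on the zeroth directed edge and have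
`m`-integral zero; for the equilibrium state `m = m_{-l}` it is the tangent space at `l` to the
moduli space of entropy one. -/
def tangentSpace (G : MultiGraph V E) (m : Measure (Subshift G.adjMat)) :
    Set (Subshift G.adjMat → ℝ) :=
  {φ | (∃ φ₀ : G.DirEdge → ℝ, ∀ x, φ x = φ₀ (Subshift.coord 0 x)) ∧ ∫ x, φ x ∂m = 0}

/-- The weighted matrix `A_{-l}(i, j) = A(i, j) e^{-l(i)}`. -/
def weightedMat (G : MultiGraph V E) (l : E → ℝ) : Matrix G.DirEdge G.DirEdge ℝ := fun i j =>
  (G.adjMat i j : ℝ) * Real.exp (-l i.1)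

/-- The matrix `P_{-l}(i, j) = A(i, j) v(i) e^{-l(i)} / v(j)`. -/
def stochMat (G : MultiGraph V E) (l : E → ℝ) (v : G.DirEdge → ℝ) :
    Matrix G.DirEdge G.DirEdge ℝ := fun i j =>
  (G.adjMat i j : ℝ) * v i * Real.exp (-l i.1) / v j

/-- `p` is the vector `p_{-l}`: one has `P_{-l} p = p` and `∑ p(i) = 1`, where `P_{-l}` is formed
with a positive left eigenvector `v` of `A_{-l}` for the eigenvalue `1`. -/
def IsStationaryVec (G : MultiGraph V E) (l : E → ℝ) (p : G.DirEdge → ℝ) : Prop :=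
  ∃ v : G.DirEdge → ℝ, (∀ i, 0 < v i) ∧ Matrix.vecMul v (G.weightedMat l) = v ∧
    Matrix.mulVec (G.stochMat l v) p = p ∧ ∑ i, p i = 1

end MultiGraph

/-! ## The belt buckle -/

namespace BeltBuckle

/-- The belt buckle: two vertices joined by three edges `e₁ = 0`, `e₂ = 1`, `e₃ = 2`. -/
def graph : MultiGraph (Fin 2) (Fin 3) := ⟨fun _ => 0, fun _ => 1⟩

/-- `S(x, y) = -log ((e^{x+y} - 1) / (e^x + e^y + 2))`. -/
def S (x y : ℝ) : ℝ :=
  -Real.log ((Real.exp (x + y) - 1) / (Real.exp x + Real.exp y + 2))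

/-- The edge weighting `l(x, y) = (x, y, S(x, y))`. -/
def l (x y : ℝ) : Fin 3 → ℝ := ![x, y, S x y]

/-- The tangent vector `∂l/∂x` at `(x, y)`. -/
def dlx (x y : ℝ) : Fin 3 → ℝ := deriv (fun t => l t y) x

/-- The tangent vector `∂l/∂y` at `(x, y)`. -/
def dly (x y : ℝ) : Fin 3 → ℝ := deriv (fun t => l x t) y

/-- `∂²S/∂x²`. -/
def Sxx (x y : ℝ) : ℝ := deriv (fun t => deriv (fun s => S s y) t) x

/-- `∂²S/∂x∂y`. -/
def Sxy (x y : ℝ) : ℝ := deriv (fun s => deriv (fun t => S s t) y) x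

/-- `∂²S/∂y²`. -/
def Syy (x y : ℝ) : ℝ := deriv (fun t => deriv (fun s => S x s) t) y

/-- The domain of the coordinates `(x, y)`: all three edge lengths `x`, `y`, `S(x, y)` are
positive. -/
def domain : Set (ℝ × ℝ) :=
  {q | 0 < q.1 ∧ 0 < q.2 ∧ Real.exp (q.1 + q.2) < 3 + Real.exp q.1 + Real.exp q.2}

/-- The common denominator of the coefficients. -/
def denom (x y : ℝ) : ℝ :=
  2 * (Real.exp x + Real.exp y + 2) * (Real.exp (x + y) - 1) *
    (3 * Real.exp (x + y) + Real.exp (2 * x + y) + Real.exp (x + 2 * y) - 1)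

/-- The coefficient `E_P`. -/
def EP (x y : ℝ) : ℝ :=
  Real.exp x * (Real.exp y + 1) ^ 2 * (Real.exp (2 * x + y) + Real.exp y + 2) / denom x y

/-- The coefficient `F_P`. -/
def FP (x y : ℝ) : ℝ :=
  (Real.exp x + 1) * (Real.exp y + 1) * Real.exp (x + y) *
    (-Real.exp (x + y) + Real.exp x + Real.exp y + 3) / denom x y

/-- The coefficient `G_P`. -/
def GP (x y : ℝ) : ℝ :=
  (Real.exp x + 1) ^ 2 * Real.exp y * (Real.exp (x + 2 * y) + Real.exp x + 2) / denom x y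

end BeltBuckle

end

open TopologicalSpace

set_option linter.unusedSectionVars false

/-! ## Perron vectors -/

/-! Write `s = e^{-l}`. A directed edge of the belt buckle is followed, and preceded, by the two
edges with other labels run in the opposite direction. So on functions of the undirected edge the
weighted matrix acts as `w ↦ ∑ s w - s_j w_j` from the left and `w ↦ s_i (∑ w - w_i)` from the
right. An eigenvector equation for the eigenvalue `1` then makes `(1 + s_j) v_j` constant: the left
eigenvector is `1/(1+s)`, the right one `s/(1+s)`, and consistency is the single equation `∑ F(l_e)
= 1` with `F(a) = 1/(1+e^a)`.

Entropy: a first-letter decomposition gives a renewal inequality for the number of paths of length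
less than `T`, and comparison with `ρ_i e^{δT}` (`exists_ncard_pathSet_le`,
`exists_le_ncard_pathSet`) shows that the entropy is the `δ` with `∑ F(δ l_e) = 1`. Hence the moduli
space is the surface `∑ F(l_e) = 1`, and solving for the third length gives `S`.

Equilibrium state: maximum principles make the eigenfunction and the dual eigenmeasure unique, and a
Krylov–Bogoliubov argument gives the eigenmeasure. The zeroth letter has law proportional to `h ρ =
s/(1+s)^2 = -F'(l)`.

Variance: if `φ = u - g` with `g` the normalised transfer of `u`, then `φ` differs by a coboundary
from the reverse martingale difference `u - g ∘ σ`, so the variance is `∫ (u² - g²)`. When `∫ φ dm =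
0`, the solution is explicit, `u = φ/(1+s)` and `g = -sφ/(1+s)`, and the variance is `∑ φ_e²
F''(l_e)` divided by `∑ -F'(l_e)`.

Differentiating the constraint once shows that `∂l/∂x` and `∂l/∂y` have mean zero. Differentiating
it twice explains the factor `2 p₃`: the form `∑ F''(l_e) φ_e ψ_e` on these tangent vectors equals
`-F'(S)` times the matching second derivative of `S`. The proof checks both expressions against the
closed form by rational algebra in `e^x` and `e^y`. -/

/-- The positive eigenvector for the eigenvalue `1` of an irreducible nonnegative matrix spans the
eigenspace. -/
theorem Matrix.exists_eq_smul_of_mulVec_eq {ι : Type*} [Fintype ι] {B : Matrix ι ι ℝ}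
    (hB : ∀ i j, 0 ≤ B i j)
    (hirr : ∀ s : Set ι, s.Nonempty → (∀ i ∈ s, ∀ j, B i j ≠ 0 → j ∈ s) → s = Set.univ)
    {u w : ι → ℝ} (hu : ∀ i, 0 < u i) (hBu : B.mulVec u = u) (hBw : B.mulVec w = w) :
    ∃ c : ℝ, w = c • u := by
  rcases isEmpty_or_nonempty ι with hι | hι
  · exact ⟨0, Subsingleton.elim _ _⟩
  -- Maximum principle: for the largest ratio `c`, the vector `c u - w` is nonnegative and fixed by
  -- `B`, so a zero at `i` forces zeros wherever row `i` of `B` is nonzero.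
  obtain ⟨i₀, hi₀⟩ := Finite.exists_max fun i => w i / u i
  set c := w i₀ / u i₀ with hc
  have hle : ∀ i, 0 ≤ c * u i - w i := fun i => by
    have := (div_le_iff₀ (hu i)).1 (hi₀ i)
    linarith
  have hs : {i | w i = c * u i} = Set.univ := by
    refine hirr _ ⟨i₀, ?_⟩ ?_
    · show w i₀ = c * u i₀
      rw [hc, div_mul_cancel₀ _ (hu i₀).ne']
    · intro i hi j hij
      have hsum : ∑ k, B i k * (c * u k - w k) = 0 := by
        have h1 := congrFun hBu i
        have h2 := congrFun hBw i
        simp only [Matrix.mulVec, dotProduct] at h1 h2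
        have hi' : w i = c * u i := hi
        rw [← sub_eq_zero] at hi'
        calc ∑ k, B i k * (c * u k - w k) = c * ∑ k, B i k * u k - ∑ k, B i k * w k := by
              rw [Finset.mul_sum, ← Finset.sum_sub_distrib]
              exact Finset.sum_congr rfl fun k _ => by ring
          _ = 0 := by rw [h1, h2]; linarith
      have := (Finset.sum_eq_zero_iff_of_nonneg
        fun k _ => mul_nonneg (hB i k) (hle k)).1 hsum j (Finset.mem_univ j)
      rcases mul_eq_zero.1 this with h | h
      · exact absurd h hij
      · show w j = c * u j
        linarith
  refine ⟨c, funext fun i => ?_⟩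
  have : i ∈ {i | w i = c * u i} := hs ▸ Set.mem_univ i
  simpa using this

/-! ## Invariant measures of positive operators -/

/-- A positive operator on `C(X)` with a strictly positive fixed function has an invariant
probability measure. -/
theorem exists_isProbabilityMeasure_integral_eq {X : Type*} [TopologicalSpace X] [CompactSpace X]
    [T2Space X] [MeasurableSpace X] [BorelSpace X] [Nonempty X]
    (T : C(X, ℝ) →ₗ[ℝ] C(X, ℝ)) (hT : ∀ w, (∀ x, 0 ≤ w x) → ∀ x, 0 ≤ T w x)
    (h : C(X, ℝ)) (hpos : ∀ x, 0 < h x) (hTh : T h = h) :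
    ∃ μ : Measure X, IsProbabilityMeasure μ ∧ ∀ φ : C(X, ℝ), ∫ x, T φ x ∂μ = ∫ x, φ x ∂μ := by
  obtain ⟨x₀⟩ := ‹Nonempty X›
  obtain ⟨x₁, -, hx₁⟩ := isCompact_univ.exists_isMinOn ⟨x₀, Set.mem_univ x₀⟩
    h.continuous.continuousOn
  have hmin : ∀ x, h x₁ ≤ h x := fun x => hx₁ (Set.mem_univ x)
  have hTle : ∀ v w : C(X, ℝ), (∀ x, v x ≤ w x) → ∀ x, T v x ≤ T w x := fun v w hvw x => by
    have := hT (w - v) (fun x => by simpa using hvw x) x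
    rw [map_sub] at this
    simpa using this
  -- The fixed function `h` replaces the constant `1`: positivity of `T` preserves the bound `|w| ≤
  -- (‖w‖ / min h) h`.
  have hbound : ∀ (w : C(X, ℝ)) (k : ℕ) (x : X), |(T ^ k) w x| ≤ ‖w‖ / h x₁ * h x := by
    intro w k
    induction k with
    | zero =>
      intro x
      calc |w x| ≤ ‖w‖ := w.norm_coe_le_norm x
        _ = ‖w‖ / h x₁ * h x₁ := by rw [div_mul_cancel₀ _ (hpos x₁).ne']
        _ ≤ ‖w‖ / h x₁ * h x := by
          gcongr
          · exact div_nonneg (norm_nonneg _) (hpos x₁).le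
          · exact hmin x
    | succ k ih =>
      intro x
      rw [pow_succ', Module.End.mul_apply]
      have e : T ((‖w‖ / h x₁) • h) = (‖w‖ / h x₁) • h := by rw [map_smul, hTh]
      rw [abs_le]
      constructor
      · have := hTle (-((‖w‖ / h x₁) • h)) ((T ^ k) w)
          (fun y => by simpa using (abs_le.1 (ih y)).1) x
        rw [map_neg, e] at this
        simpa using this
      · have := hTle ((T ^ k) w) ((‖w‖ / h x₁) • h)
          (fun y => by simpa using (abs_le.1 (ih y)).2) x
        rw [e] at this
        simpa using this
  -- Krylov–Bogoliubov averages of the dual orbit of the point mass at `x₀`.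
  set a : ℕ → C(X, ℝ) → ℝ :=
    fun N w => (N + 1 : ℝ)⁻¹ * ∑ k ∈ Finset.range (N + 1), (T ^ k) w x₀ with ha
  have hN : ∀ N : ℕ, (0 : ℝ) < N + 1 := fun N => by positivity
  have habs : ∀ w N, |a N w| ≤ ‖w‖ / h x₁ * h x₀ := by
    intro w N
    rw [ha]
    simp only
    rw [abs_mul, abs_of_pos (inv_pos.2 (hN N)), inv_mul_le_iff₀ (hN N)]
    calc _ ≤ ∑ k ∈ Finset.range (N + 1), |(T ^ k) w x₀| := Finset.abs_sum_le_sum_abs _ _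
      _ ≤ ∑ k ∈ Finset.range (N + 1), ‖w‖ / h x₁ * h x₀ :=
        Finset.sum_le_sum fun k _ => hbound w k x₀
      _ = _ := by simp
  -- An ultrafilter makes the averages of all `w` converge at once, so the limit is linear and no
  -- subsequences are chosen.
  set U : Ultrafilter ℕ := Ultrafilter.of atTop
  have hU : (U : Filter ℕ) ≤ atTop := Ultrafilter.of_le _
  have hlim : ∀ w, ∃ r, Tendsto (fun N => a N w) U (𝓝 r) := by
    intro w
    obtain ⟨r, -, hr⟩ := (isCompact_Icc (a := -(‖w‖ / h x₁ * h x₀))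
      (b := ‖w‖ / h x₁ * h x₀)).ultrafilter_le_nhds' (U.map fun N => a N w)
        (Ultrafilter.mem_map.2 (Filter.Eventually.of_forall fun N => abs_le.1 (habs w N)))
    exact ⟨r, hr⟩
  choose Λ hΛ using hlim
  have hΛT : ∀ w, Λ (T w) = Λ w := by
    intro w
    have h0 : Tendsto (fun N => a N (T w) - a N w) U (𝓝 0) := by
      have hb : ∀ N : ℕ, |a N (T w) - a N w| ≤ 2 * (‖w‖ / h x₁ * h x₀) * (N + 1 : ℝ)⁻¹ := by
        intro N
        have : a N (T w) - a N w = (N + 1 : ℝ)⁻¹ * ((T ^ (N + 1)) w x₀ - w x₀) := by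
          simp only [ha]
          rw [← mul_sub, ← Finset.sum_sub_distrib]
          congr 1
          have := Finset.sum_range_sub (fun k => (T ^ k) w x₀) (N + 1)
          simpa [pow_succ, Module.End.mul_apply] using this
        rw [this, abs_mul, abs_of_pos (inv_pos.2 (hN N)), mul_comm]
        gcongr
        calc _ ≤ |(T ^ (N + 1)) w x₀| + |w x₀| := abs_sub _ _
          _ ≤ _ := by
            have h1 := hbound w (N + 1) x₀
            have h2 := hbound w 0 x₀
            simp only [pow_zero, Module.End.one_apply] at h2
            linarith
      refine squeeze_zero_norm hb (Tendsto.mono_left ?_ hU)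
      have : Tendsto (fun N : ℕ => 2 * (‖w‖ / h x₁ * h x₀) * (1 / ((N : ℝ) + 1))) atTop
          (𝓝 (2 * (‖w‖ / h x₁ * h x₀) * 0)) :=
        tendsto_one_div_add_atTop_nhds_zero_nat.const_mul _
      simpa using this
    have := tendsto_nhds_unique h0 ((hΛ (T w)).sub (hΛ w))
    linarith
  -- Since `h x₀ > 0`, this keeps the limit functional from vanishing, so its measure can be
  -- normalised.
  have hΛh : Λ h = h x₀ := by
    have hk : ∀ k, (T ^ k) h = h := fun k => by
      induction k with
      | zero => rfl
      | succ k ih => rw [pow_succ, Module.End.mul_apply, hTh, ih]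
    refine tendsto_nhds_unique (hΛ h) (tendsto_const_nhds.congr fun N => ?_)
    have := (hN N).ne'
    simp only [ha, hk, Finset.sum_const, Finset.card_range, nsmul_eq_mul, Nat.cast_add,
      Nat.cast_one]
    field_simp
  have hTk : ∀ k w, (∀ x, 0 ≤ w x) → ∀ x, 0 ≤ (T ^ k) w x := fun k => by
    induction k with
    | zero => exact fun w hw => hw
    | succ k ih =>
      intro w hw x
      rw [pow_succ, Module.End.mul_apply]
      exact ih _ (hT w hw) x
  have hadd : ∀ v w, Λ (v + w) = Λ v + Λ w := fun v w => by
    refine tendsto_nhds_unique (hΛ _) (((hΛ v).add (hΛ w)).congr fun N => ?_)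
    simp only [ha, ← mul_add, ← Finset.sum_add_distrib, map_add, ContinuousMap.add_apply]
  have hsmul : ∀ (c : ℝ) w, Λ (c • w) = c * Λ w := fun c w => by
    refine tendsto_nhds_unique (hΛ _) (((hΛ w).const_mul c).congr fun N => ?_)
    simp only [ha, map_smul, ContinuousMap.smul_apply, smul_eq_mul, ← Finset.mul_sum]
    ring
  have hnonneg : ∀ w, (∀ x, 0 ≤ w x) → 0 ≤ Λ w := fun w hw =>
    ge_of_tendsto' (hΛ w) fun N =>
      mul_nonneg (inv_pos.2 (hN N)).le (Finset.sum_nonneg fun k _ => hTk k w hw x₀)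
  let Λ' : CompactlySupportedContinuousMap X ℝ →ₚ[ℝ] ℝ :=
    { toFun := fun g => Λ g.toContinuousMap
      map_add' := fun g g' => hadd _ _
      map_smul' := fun c g => hsmul _ _
      monotone' := fun g g' hgg' => by
        have h1 := hnonneg (g'.toContinuousMap - g.toContinuousMap)
          (fun x => sub_nonneg.2 (hgg' x))
        have h2 := hadd (g'.toContinuousMap - g.toContinuousMap) g.toContinuousMap
        rw [sub_add_cancel] at h2
        show Λ g.toContinuousMap ≤ Λ g'.toContinuousMap
        linarith }
  set μ := RealRMK.rieszMeasure Λ' with hμ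
  have hint : ∀ w : C(X, ℝ), ∫ x, w x ∂μ = Λ w := fun w =>
    RealRMK.integral_rieszMeasure Λ' ⟨w, HasCompactSupport.of_compactSpace w⟩
  have hμ0 : μ ≠ 0 := fun h0 => by
    have := hint h
    rw [h0, integral_zero_measure, hΛh] at this
    exact (hpos x₀).ne this
  have : NeZero μ := ⟨hμ0⟩
  refine ⟨(μ Set.univ)⁻¹ • μ, inferInstance, fun φ => ?_⟩
  rw [integral_smul_measure, integral_smul_measure, hint, hint, hΛT]

/-! ### Cylinder sets -/

namespace Subshift

section Cylinders

variable {ι : Type*} {A : Matrix ι ι ℕ}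

@[simp] theorem coord_zero_cons (i : ι) (x : Subshift A) (h : A i (coord 0 x) = 1) :
    coord 0 (cons i x h) = i := rfl

@[simp] theorem shift_cons (i : ι) (x : Subshift A) (h : A i (coord 0 x) = 1) :
    shift (cons i x h) = x := rfl

@[simp] theorem coord_shift (n : ℕ) (x : Subshift A) : coord n (shift x) = coord (n + 1) x := rfl

/-- The cylinder of the points that begin with `s₀, …, sₙ₋₁`. -/
def cylinder (s : ℕ → ι) (n : ℕ) : Set (Subshift A) := {x | ∀ k < n, coord k x = s k}

theorem mem_cylinder {s : ℕ → ι} {n : ℕ} {x : Subshift A} :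
    x ∈ cylinder s n ↔ ∀ k < n, coord k x = s k := Iff.rfl

theorem cons_mem_cylinder {s : ℕ → ι} {n : ℕ} {i : ι} {x : Subshift A}
    (h : A i (coord 0 x) = 1) :
    cons i x h ∈ cylinder s (n + 1) ↔ i = s 0 ∧ x ∈ cylinder (fun k => s (k + 1)) n := by
  constructor
  · intro hx
    exact ⟨hx 0 n.succ_pos, fun k hk => hx (k + 1) (Nat.succ_lt_succ hk)⟩
  · rintro ⟨hi, hx⟩ k hk
    cases k with
    | zero => exact hi
    | succ k => exact hx k (Nat.lt_of_succ_lt_succ hk)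

variable [TopologicalSpace ι] [DiscreteTopology ι]

theorem continuous_shift : Continuous (shift : Subshift A → Subshift A) :=
  Continuous.subtype_mk (continuous_pi fun n => continuous_coord (n + 1)) _

theorem isClopen_cylinder (s : ℕ → ι) (n : ℕ) : IsClopen (cylinder s n : Set (Subshift A)) := by
  have : (cylinder s n : Set (Subshift A)) = ⋂ k ∈ Set.Iio n, coord k ⁻¹' {s k} := by
    ext x
    simp [mem_cylinder]
  rw [this]
  exact (Set.finite_Iio n).isClopen_biInter fun k _ =>
    (isClopen_discrete {s k}).preimage (continuous_coord k)

theorem isTopologicalBasis_cylinder :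
    IsTopologicalBasis {S : Set (Subshift A) | ∃ s n, S = cylinder s n} := by
  have h := (PiNat.isTopologicalBasis_cylinders (fun _ : ℕ => ι)).induced
    (Subtype.val : Subshift A → ℕ → ι)
  have e : {S : Set (Subshift A) | ∃ s n, S = cylinder s n} =
      Set.preimage (Subtype.val : Subshift A → ℕ → ι) ''
        {S | ∃ s n, S = PiNat.cylinder s n} := by
    ext S
    constructor
    · rintro ⟨s, n, rfl⟩
      exact ⟨_, ⟨s, n, rfl⟩, rfl⟩
    · rintro ⟨_, ⟨s, n, rfl⟩, rfl⟩
      exact ⟨s, n, rfl⟩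
  rw [e]
  exact h

theorem isPiSystem_cylinder : IsPiSystem {S : Set (Subshift A) | ∃ s n, S = cylinder s n} := by
  rintro _ ⟨s, n, rfl⟩ _ ⟨s', n', rfl⟩ ⟨x, hx, hx'⟩
  refine ⟨x.1, max n n', Set.ext fun y => ⟨fun hy k hk => ?_, fun hy => ⟨fun k hk => ?_,
    fun k hk => ?_⟩⟩⟩
  · rcases lt_max_iff.1 hk with hk | hk
    · exact (hy.1 k hk).trans (hx k hk).symm
    · exact (hy.2 k hk).trans (hx' k hk).symm
  · exact (hy k (lt_max_of_lt_left hk)).trans (hx k hk)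
  · exact (hy k (lt_max_of_lt_right hk)).trans (hx' k hk)

theorem measure_ext_cylinder [Finite ι] {μ ν : Measure (Subshift A)} [IsFiniteMeasure μ]
    (h : ∀ s n, μ (cylinder s n) = ν (cylinder s n)) : μ = ν := by
  have : Countable ι := Finite.to_countable
  have : SecondCountableTopology ι := inferInstance
  have : SecondCountableTopology (Subshift A) :=
    TopologicalSpace.Subtype.secondCountableTopology _
  refine ext_of_generate_finite _ (isTopologicalBasis_cylinder.borel_eq_generateFrom)
    isPiSystem_cylinder ?_ ?_
  · rintro _ ⟨s, n, rfl⟩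
    exact h s n
  · rcases isEmpty_or_nonempty ι with hι | ⟨⟨i⟩⟩
    · have : IsEmpty (Subshift A) := ⟨fun x => hι.elim (x.1 0)⟩
      simp [Set.eq_empty_of_isEmpty]
    · have e : (cylinder (fun _ => i) 0 : Set (Subshift A)) = Set.univ :=
        Set.eq_univ_of_forall fun x k hk => absurd hk k.not_lt_zero
      rw [← e]
      exact h _ 0

end Cylinders

/-! ### Transfer operators of functions of the zeroth letter -/

section LetterMat

variable {ι : Type*} {A : Matrix ι ι ℕ}

/-- The matrix of the transfer operator of a function with weights `e^f = t ∘ coord 0`, acting on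
the functions of the zeroth letter. -/
noncomputable def letterMat (A : Matrix ι ι ℕ) (t : ι → ℝ) : Matrix ι ι ℝ := Matrix.of fun i j =>
  open scoped Classical in if A i j = 1 then t i else 0

theorem letterMat_of_eq {t : ι → ℝ} {i j : ι} (h : A i j = 1) : letterMat A t i j = t i := by
  simp [letterMat, h]

theorem letterMat_of_ne {t : ι → ℝ} {i j : ι} (h : ¬ A i j = 1) : letterMat A t i j = 0 := by
  simp [letterMat, h]

theorem letterMat_nonneg {t : ι → ℝ} (ht : ∀ i, 0 < t i) (i j : ι) : 0 ≤ letterMat A t i j := by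
  by_cases h : A i j = 1
  · rw [letterMat_of_eq h]; exact (ht i).le
  · rw [letterMat_of_ne h]

end LetterMat

variable {ι : Type*} [Fintype ι] [TopologicalSpace ι] [DiscreteTopology ι] {A : Matrix ι ι ℕ}

/-- A continuous function of the zeroth letter. -/
def letterFun (A : Matrix ι ι ℕ) (w : ι → ℝ) : C(Subshift A, ℝ) :=
  ⟨fun x => w (coord 0 x), (continuous_of_discreteTopology (f := w)).comp (continuous_coord 0)⟩

@[simp] theorem letterFun_apply (w : ι → ℝ) (x : Subshift A) :
    letterFun A w x = w (coord 0 x) := rfl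

section Transfer

variable {f : C(Subshift A, ℝ)} {t : ι → ℝ}

theorem transfer_eq_sum (hf : ∀ x, Real.exp (f x) = t (coord 0 x)) (w : Subshift A → ℝ)
    (x : Subshift A) :
    transfer f w x = ∑ i, if h : A i (coord 0 x) = 1 then t i * w (cons i x h) else 0 := by
  refine Finset.sum_congr rfl fun i _ => ?_
  split_ifs with h
  · rw [hf, smul_eq_mul, coord_zero_cons]
  · rfl

/-- `φ ∘ shift` takes the value `φ x` at every preimage of `x` and comes out of the sum; what
remains is a product of a vector with a matrix. This reduces the transfer operator to finite linear
algebra. -/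
theorem transfer_letter_mul_shift (hf : ∀ x, Real.exp (f x) = t (coord 0 x)) (w : ι → ℝ)
    (φ : Subshift A → ℝ) (x : Subshift A) :
    transfer f (fun y => φ (shift y) * w (coord 0 y)) x =
      φ x * Matrix.vecMul w (letterMat A t) (coord 0 x) := by
  rw [transfer_eq_sum hf, Matrix.vecMul, dotProduct, Finset.mul_sum]
  refine Finset.sum_congr rfl fun i _ => ?_
  split_ifs with h
  · rw [letterMat_of_eq h, shift_cons, coord_zero_cons]; ring
  · rw [letterMat_of_ne h]; ring

@[simp] theorem coe_letterFun (w : ι → ℝ) :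
    ⇑(letterFun A w) = fun x => w (coord 0 x) := rfl

theorem transfer_letterFun (hf : ∀ x, Real.exp (f x) = t (coord 0 x)) {h : ι → ℝ}
    (hh : Matrix.vecMul h (letterMat A t) = h) (x : Subshift A) :
    transfer f (letterFun A h) x = h (coord 0 x) := by
  have := transfer_letter_mul_shift hf h (fun _ => 1) x
  rw [hh] at this
  simpa using this

/-- The real transfer operator as a linear map on continuous functions. -/
noncomputable def transferLin (f : C(Subshift A, ℝ)) : C(Subshift A, ℝ) →ₗ[ℝ] C(Subshift A, ℝ) where
  toFun w := ⟨transfer f w, continuous_transfer f.continuous w.continuous⟩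
  map_add' w w' := by
    ext x
    simp only [transfer, ContinuousMap.coe_mk, ContinuousMap.add_apply, ← Finset.sum_add_distrib]
    refine Finset.sum_congr rfl fun i _ => ?_
    split_ifs <;> simp [mul_add]
  map_smul' c w := by
    ext x
    simp only [transfer, ContinuousMap.coe_mk, ContinuousMap.smul_apply, RingHom.id_apply,
      Finset.smul_sum]
    refine Finset.sum_congr rfl fun i _ => ?_
    split_ifs
    · exact smul_comm _ _ _
    · simp

/-- A positive continuous eigenfunction is unique up to scaling, and depends only on the zeroth
letter. -/
theorem exists_eq_mul_of_transfer_eq (hf : ∀ x, Real.exp (f x) = t (coord 0 x))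
    (hirr : ∀ s : Set ι, s.Nonempty → (∀ i j, A i j = 1 → j ∈ s → i ∈ s) → s = Set.univ)
    (ht : ∀ i, 0 < t i) {h : ι → ℝ} (hpos : ∀ i, 0 < h i)
    (hh : Matrix.vecMul h (letterMat A t) = h)
    {v : C(Subshift A, ℝ)} (hv : ∀ x, transfer f v x = v x) :
    ∃ c : ℝ, ∀ x, v x = c * h (coord 0 x) := by
  rcases isEmpty_or_nonempty (Subshift A) with hX | hX
  · exact ⟨0, fun x => hX.elim x⟩
  -- The same maximum principle on a compact space: the set where `v / h` attains its maximum is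
  -- closed, stable under preimages and, by irreducibility, dense.
  obtain ⟨x₀, -, hx₀⟩ := isCompact_univ.exists_isMaxOn (Set.univ_nonempty (α := Subshift A))
    (f := fun x => v x / letterFun A h x)
    (v.continuous.div (letterFun A h).continuous fun x => (hpos _).ne').continuousOn
  set c := v x₀ / h (coord 0 x₀) with hc
  have hle : ∀ x, 0 ≤ c * h (coord 0 x) - v x := fun x => by
    have h1 : v x / h (coord 0 x) ≤ c := hx₀ (Set.mem_univ x)
    have := (div_le_iff₀ (hpos _)).1 h1
    linarith
  have hstep : ∀ x, v x = c * h (coord 0 x) → ∀ i (hi : A i (coord 0 x) = 1),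
      v (cons i x hi) = c * h i := by
    intro x hx i hi
    have hsum : ∑ k, (if hk : A k (coord 0 x) = 1 then
        t k * (c * h k - v (cons k x hk)) else 0) = 0 := by
      have h1 := hv x
      have h2 := transfer_letterFun hf hh x
      rw [transfer_eq_sum hf] at h1 h2
      calc _ = c * (∑ k, if hk : A k (coord 0 x) = 1 then
              t k * letterFun A h (cons k x hk) else 0) -
            ∑ k, if hk : A k (coord 0 x) = 1 then t k * v (cons k x hk) else 0 := by
            rw [Finset.mul_sum, ← Finset.sum_sub_distrib]
            refine Finset.sum_congr rfl fun k _ => ?_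
            split_ifs with hk
            · rw [letterFun_apply, coord_zero_cons]; ring
            · ring
        _ = 0 := by rw [h1, h2]; linarith
    have h0 := (Finset.sum_eq_zero_iff_of_nonneg (fun k _ => by
      split_ifs with hk
      · exact mul_nonneg (ht k).le (hle (cons k x hk))
      · exact le_rfl)).1 hsum i (Finset.mem_univ i)
    rw [dif_pos hi] at h0
    rcases mul_eq_zero.1 h0 with h' | h'
    · exact absurd h' (ht i).ne'
    · linarith
  have hlet : {i | ∃ x, v x = c * h (coord 0 x) ∧ coord 0 x = i} = Set.univ := by
    refine hirr _ ⟨coord 0 x₀, x₀, ?_, rfl⟩ ?_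
    · rw [hc, div_mul_cancel₀ _ (hpos _).ne']
    · rintro i j hij ⟨x, hx, rfl⟩
      exact ⟨cons i x hij, hstep x hx i hij, rfl⟩
  -- Every admissible word begins a point of the contact set: start from its last letter and prepend
  -- the others one by one.
  have hword : ∀ n (z : Subshift A), ∃ x ∈ cylinder z.1 (n + 1), v x = c * h (coord 0 x) := by
    intro n
    induction n with
    | zero =>
      intro z
      obtain ⟨x, hx, hxz⟩ : coord 0 z ∈ {i | ∃ x, v x = c * h (coord 0 x) ∧ coord 0 x = i} :=
        hlet ▸ Set.mem_univ _
      refine ⟨x, fun k hk => ?_, hx⟩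
      obtain rfl : k = 0 := by omega
      exact hxz
    | succ n ih =>
      intro z
      obtain ⟨x, hxz, hx⟩ := ih (shift z)
      have h1 : A (coord 0 z) (coord 0 x) = 1 := by
        rw [hxz 0 n.succ_pos]
        exact z.2 0
      exact ⟨cons (coord 0 z) x h1, (cons_mem_cylinder h1).2 ⟨rfl, hxz⟩, hstep x hx _ h1⟩
  have hdense : Dense {x | v x = c * letterFun A h x} := by
    rw [isTopologicalBasis_cylinder.dense_iff]
    rintro _ ⟨s, n, rfl⟩ ⟨z, hz⟩
    obtain ⟨x, hxz, hx⟩ := hword n z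
    exact ⟨x, fun k hk => (hxz k (hk.trans n.lt_succ_self)).trans (hz k hk), hx⟩
  have hcl : IsClosed {x | v x = c * letterFun A h x} :=
    isClosed_eq v.continuous ((letterFun A h).continuous.const_mul c)
  refine ⟨c, fun x => ?_⟩
  have : x ∈ {x | v x = c * letterFun A h x} := by
    rw [← hcl.closure_eq, hdense.closure_eq]
    trivial
  exact this

theorem exists_measure_integral_transfer_eq [Nonempty (Subshift A)]
    (hf : ∀ x, Real.exp (f x) = t (coord 0 x)) {h : ι → ℝ} (hpos : ∀ i, 0 < h i)
    (hh : Matrix.vecMul h (letterMat A t) = h) :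
    ∃ μ : Measure (Subshift A), IsProbabilityMeasure μ ∧
      ∀ φ : C(Subshift A, ℝ), ∫ x, transfer f φ x ∂μ = ∫ x, φ x ∂μ := by
  refine exists_isProbabilityMeasure_integral_eq (transferLin f) (fun w hw x => ?_)
    (letterFun A h) (fun x => hpos _) ?_
  · refine Finset.sum_nonneg fun i _ => ?_
    split_ifs with hi
    · exact smul_nonneg (Real.exp_pos _).le (hw _)
    · exact le_rfl
  · ext x
    exact transfer_letterFun hf hh x

/-! ### Uniqueness of the dual eigenmeasure -/

section Dual

variable {μ : Measure (Subshift A)} [IsProbabilityMeasure μ]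

theorem integral_letter (w : ι → ℝ) :
    ∫ x, w (coord 0 x) ∂μ = ∑ i, w i * μ.real (coord 0 ⁻¹' {i}) := by
  classical
  have hm : ∀ i, MeasurableSet (coord 0 ⁻¹' {i} : Set (Subshift A)) := fun i =>
    ((isClopen_discrete {i}).preimage (continuous_coord 0)).isOpen.measurableSet
  have : ∀ x : Subshift A, w (coord 0 x) =
      ∑ i, (coord 0 ⁻¹' {i} : Set (Subshift A)).indicator (fun _ => w i) x := by
    intro x
    rw [Finset.sum_eq_single (coord 0 x)]
    · simp
    · intro i _ hi
      exact Set.indicator_of_notMem (fun h => hi h.symm) _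
    · simp
  simp_rw [this]
  rw [integral_finsetSum _ fun i _ => (integrable_const _).indicator (hm i)]
  refine Finset.sum_congr rfl fun i _ => ?_
  rw [integral_indicator_const _ (hm i), smul_eq_mul, mul_comm]

/-- The transfer operator sends the indicator of the letter `i` to the function `letterMat A t i
(coord 0 x)`; integrating it gives row `i` of the eigenvector equation. -/
theorem measureReal_letter (hf : ∀ x, Real.exp (f x) = t (coord 0 x))
    (hμ : ∀ φ : C(Subshift A, ℝ), ∫ x, transfer f φ x ∂μ = ∫ x, φ x ∂μ) :
    (letterMat A t).mulVec (fun i => μ.real (coord 0 ⁻¹' {i})) =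
      fun i => μ.real (coord 0 ⁻¹' {i}) := by
  classical
  funext i
  have h1 := hμ (letterFun A (Pi.single i 1))
  have h2 : ∀ x : Subshift A, transfer f (letterFun A (Pi.single i 1)) x =
      letterMat A t i (coord 0 x) := fun x => by
    have := transfer_letter_mul_shift hf (Pi.single i 1) (fun _ => 1) x
    simpa using this
  simp_rw [h2, letterFun_apply] at h1
  rw [integral_letter, integral_letter] at h1
  simpa [Matrix.mulVec, dotProduct, Pi.single_apply] using h1

/-- The probability measure fixed by the dual of the transfer operator is unique. -/
theorem measure_eq_of_integral_transfer_eq (hf : ∀ x, Real.exp (f x) = t (coord 0 x))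
    (huniq : ∀ w w' : ι → ℝ, (letterMat A t).mulVec w = w → (letterMat A t).mulVec w' = w' →
      ∑ i, w i = 1 → ∑ i, w' i = 1 → w = w')
    (hμ : ∀ φ : C(Subshift A, ℝ), ∫ x, transfer f φ x ∂μ = ∫ x, φ x ∂μ)
    {ν : Measure (Subshift A)} [IsProbabilityMeasure ν]
    (hν : ∀ φ : C(Subshift A, ℝ), ∫ x, transfer f φ x ∂ν = ∫ x, φ x ∂ν) : μ = ν := by
  have hsum : ∀ (κ : Measure (Subshift A)) [IsProbabilityMeasure κ],
      ∑ i, κ.real (coord 0 ⁻¹' {i}) = 1 := fun κ _ => by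
    have := integral_letter (μ := κ) (fun _ => 1)
    simpa using this.symm
  have hlet := huniq _ _ (measureReal_letter hf hμ) (measureReal_letter hf hν) (hsum μ) (hsum ν)
  -- Invariance tested on the indicator of a cylinder strips its first letter. At least two letters
  -- are needed, so that the matrix entry is determined by the word.
  have hrec : ∀ (κ : Measure (Subshift A)) [IsProbabilityMeasure κ],
      (∀ φ : C(Subshift A, ℝ), ∫ x, transfer f φ x ∂κ = ∫ x, φ x ∂κ) → ∀ s n,
      κ.real (cylinder s (n + 2)) =
        letterMat A t (s 0) (s 1) * κ.real (cylinder (fun k => s (k + 1)) (n + 1)) := by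
    intro κ _ hκ s n
    have hc := isClopen_cylinder (A := A) s (n + 2)
    have hc' := isClopen_cylinder (A := A) (fun k => s (k + 1)) (n + 1)
    have h1 := hκ ⟨(cylinder s (n + 2)).indicator fun _ => 1,
      hc.continuous_indicator continuous_const⟩
    have h2 : ∀ x : Subshift A, transfer f ((cylinder s (n + 2)).indicator fun _ => (1 : ℝ)) x =
        (cylinder (fun k => s (k + 1)) (n + 1)).indicator
          (fun _ => letterMat A t (s 0) (s 1)) x := by
      intro x
      rw [transfer_eq_sum hf, Finset.sum_eq_single (s 0)]
      · by_cases hx : x ∈ cylinder (fun k => s (k + 1)) (n + 1)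
        · have h0 : coord 0 x = s 1 := hx 0 n.succ_pos
          rw [Set.indicator_of_mem hx]
          by_cases hA : A (s 0) (coord 0 x) = 1
          · rw [dif_pos hA, Set.indicator_of_mem ((cons_mem_cylinder hA).2 ⟨rfl, hx⟩), mul_one,
              letterMat_of_eq (by rwa [← h0])]
          · rw [dif_neg hA, letterMat_of_ne (by rwa [← h0])]
        · rw [Set.indicator_of_notMem hx]
          split_ifs with hA
          · rw [Set.indicator_of_notMem fun h => hx ((cons_mem_cylinder hA).1 h).2, mul_zero]
          · rfl
      · intro i _ hi
        split_ifs with hA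
        · rw [Set.indicator_of_notMem fun h => hi ((cons_mem_cylinder hA).1 h).1, mul_zero]
        · rfl
      · simp
    simp only [ContinuousMap.coe_mk, h2] at h1
    rw [integral_indicator_const _ hc.isOpen.measurableSet,
      integral_indicator_const _ hc'.isOpen.measurableSet] at h1
    simp only [smul_eq_mul, mul_one] at h1
    rw [← h1, mul_comm]
  have key : ∀ n s, μ.real (cylinder s (n + 1)) = ν.real (cylinder s (n + 1)) := by
    intro n
    induction n with
    | zero =>
      intro s
      have : (cylinder s (0 + 1) : Set (Subshift A)) = coord 0 ⁻¹' {s 0} := by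
        ext x
        simp [mem_cylinder]
      rw [this]
      exact congrFun hlet (s 0)
    | succ n ih =>
      intro s
      rw [hrec μ hμ, hrec ν hν, ih]
  refine measure_ext_cylinder fun s n => ?_
  cases n with
  | zero =>
    have e : (cylinder s 0 : Set (Subshift A)) = Set.univ :=
      Set.eq_univ_of_forall fun x k hk => absurd hk k.not_lt_zero
    rw [e, measure_univ, measure_univ]
  | succ n => exact (measureReal_eq_measureReal_iff).1 (key n s)

end Dual

end Transfer

end Subshift

/-! ### Spectral radius -/

/-- If `k` lies in the spectrum of `a`, then `k ^ n` lies in that of `a ^ n`, so `‖k‖ ^ n` stays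
bounded. -/
theorem spectralRadius_le_one_of_norm_pow_le {B : Type*} [NormedRing B] [NormedAlgebra ℂ B]
    [CompleteSpace B] {a : B} {K : ℝ} (h : ∀ n, ‖a ^ n‖ ≤ K) : spectralRadius ℂ a ≤ 1 := by
  refine iSup₂_le fun k hk => ?_
  by_contra! hlt
  have hk1 : 1 < ‖k‖ := by exact_mod_cast hlt
  obtain ⟨n, hn⟩ := ((tendsto_pow_atTop_atTop_of_one_lt hk1).eventually_gt_atTop
    (K * ‖(1 : B)‖)).exists
  have h1 := spectrum.norm_le_norm_mul_of_mem (spectrum.pow_mem_pow a n hk)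
  have h2 := mul_le_mul_of_nonneg_right (h n) (norm_nonneg (1 : B))
  rw [norm_pow] at h1
  linarith

theorem one_le_spectralRadius_of_apply_eq {E : Type*} [NormedAddCommGroup E] [NormedSpace ℂ E]
    {T : E →L[ℂ] E} {w : E} (hw : w ≠ 0) (hT : T w = w) : 1 ≤ spectralRadius ℂ T := by
  have hmem : (1 : ℂ) ∈ spectrum ℂ T := by
    rintro ⟨u, hu⟩
    have h0 : u.1 w = 0 := by
      rw [hu, map_one]
      simp [hT]
    have h1 : (u⁻¹.1 * u.1) w = 0 := by
      show u⁻¹.1 (u.1 w) = 0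
      rw [h0, map_zero]
    rw [Units.inv_mul] at h1
    exact hw h1
  calc (1 : ENNReal) = (‖(1 : ℂ)‖₊ : ENNReal) := by simp
    _ ≤ _ := le_iSup₂ (α := ENNReal) (f := fun k (_ : k ∈ spectrum ℂ T) =>
      (‖k‖₊ : ENNReal)) 1 hmem

/-! ### Pressure, existence and uniqueness of the equilibrium state -/

namespace Subshift

variable {ι : Type*} [Fintype ι] [TopologicalSpace ι] [DiscreteTopology ι] {A : Matrix ι ι ℕ}

/-- The weights `e^f = t ∘ coord 0` of an irreducible subshift, with positive left and right
eigenvectors `h` and `ρ` of the transfer matrix for the eigenvalue `1`. -/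
structure IsPerron (f : C(Subshift A, ℝ)) (t h ρ : ι → ℝ) : Prop where
  exp_eq : ∀ x, Real.exp (f x) = t (coord 0 x)
  pos : ∀ i, 0 < t i
  pred_closed : ∀ s : Set ι, s.Nonempty → (∀ i j, A i j = 1 → j ∈ s → i ∈ s) → s = Set.univ
  succ_closed : ∀ s : Set ι, s.Nonempty → (∀ i j, A i j = 1 → i ∈ s → j ∈ s) → s = Set.univ
  left_pos : ∀ i, 0 < h i
  vecMul_left : Matrix.vecMul h (letterMat A t) = h
  right_pos : ∀ i, 0 < ρ i
  mulVec_right : (letterMat A t).mulVec ρ = ρ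

namespace IsPerron

variable {f : C(Subshift A, ℝ)} {t h ρ : ι → ℝ} (H : IsPerron f t h ρ)
include H

theorem letterMat_ne_zero {i j : ι} : letterMat A t i j ≠ 0 ↔ A i j = 1 := by
  constructor
  · intro h
    by_contra h'
    exact h (letterMat_of_ne h')
  · intro h
    rw [letterMat_of_eq h]
    exact (H.pos i).ne'

theorem exists_eq_smul_right {w : ι → ℝ} (hw : (letterMat A t).mulVec w = w) :
    ∃ c : ℝ, w = c • ρ :=
  Matrix.exists_eq_smul_of_mulVec_eq (letterMat_nonneg H.pos)
    (fun s hs h => H.succ_closed s hs fun i j hij hi =>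
      h i hi j (H.letterMat_ne_zero.2 hij)) H.right_pos H.mulVec_right hw

theorem exists_eq_smul_left {w : ι → ℝ} (hw : Matrix.vecMul w (letterMat A t) = w) :
    ∃ c : ℝ, w = c • h := by
  refine Matrix.exists_eq_smul_of_mulVec_eq (B := (letterMat A t).transpose)
    (fun i j => letterMat_nonneg H.pos j i)
    (fun s hs h => H.pred_closed s hs fun i j hij hj =>
      h j hj i (H.letterMat_ne_zero.2 hij)) H.left_pos ?_ ?_
  · rw [Matrix.mulVec_transpose, H.vecMul_left]
  · rw [Matrix.mulVec_transpose, hw]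

theorem eq_of_sum_eq_one (w w' : ι → ℝ) (hw : (letterMat A t).mulVec w = w)
    (hw' : (letterMat A t).mulVec w' = w') (h1 : ∑ i, w i = 1) (h1' : ∑ i, w' i = 1) :
    w = w' := by
  obtain ⟨c, rfl⟩ := H.exists_eq_smul_right hw
  obtain ⟨c', rfl⟩ := H.exists_eq_smul_right hw'
  simp only [Pi.smul_apply, smul_eq_mul, ← Finset.mul_sum] at h1 h1'
  have h0 : ∑ i, ρ i ≠ 0 := fun h0 => by simp [h0] at h1
  rw [mul_right_cancel₀ h0 (h1.trans h1'.symm)]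

theorem exists_le_left [Nonempty (Subshift A)] : ∃ δ > 0, ∀ i, δ ≤ h i := by
  obtain ⟨x⟩ := ‹Nonempty (Subshift A)›
  have : Nonempty ι := ⟨coord 0 x⟩
  obtain ⟨i, hi⟩ := Finite.exists_min h
  exact ⟨h i, H.left_pos i, hi⟩

/-- The operator is positive and fixes `h`, so a bound by a multiple of `h` survives every
iteration. This makes the powers uniformly bounded. -/
theorem norm_pow_transferCLM_apply_le {δ : ℝ} (hδ : 0 < δ) (hle : ∀ i, δ ≤ h i)
    (w : C(Subshift A, ℂ)) (n : ℕ) (x : Subshift A) :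
    ‖(transferCLM f ^ n) w x‖ ≤ ‖w‖ / δ * h (coord 0 x) := by
  induction n generalizing x with
  | zero =>
    calc ‖w x‖ ≤ ‖w‖ := w.norm_coe_le_norm x
      _ = ‖w‖ / δ * δ := by rw [div_mul_cancel₀ _ hδ.ne']
      _ ≤ ‖w‖ / δ * h (coord 0 x) := by gcongr; exact hle _
  | succ n ih =>
    rw [pow_succ']
    change ‖transferCLM f ((transferCLM f ^ n) w) x‖ ≤ _
    set u := (transferCLM f ^ n) w
    have h1 := transfer_letterFun H.exp_eq H.vecMul_left x
    rw [transfer_eq_sum H.exp_eq] at h1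
    calc ‖transfer f u x‖ ≤ ∑ i, (‖w‖ / δ) * (if hi : A i (coord 0 x) = 1 then
          t i * letterFun A h (cons i x hi) else 0) := by
          refine norm_sum_le_of_le _ fun i _ => ?_
          split_ifs with hi
          · rw [norm_smul, Real.norm_eq_abs, Real.abs_exp, H.exp_eq]
            calc t i * ‖u (cons i x hi)‖ ≤ t i * (‖w‖ / δ * h i) := by
                  gcongr
                  · exact (H.pos i).le
                  · exact ih (cons i x hi)
              _ = _ := by simp; ring
          · simp
      _ = _ := by rw [← Finset.mul_sum, h1]

theorem pressure_eq_zero [Nonempty (Subshift A)] : pressure f = 0 := by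
  obtain ⟨δ, hδ, hle⟩ := H.exists_le_left
  obtain ⟨x₀⟩ := ‹Nonempty (Subshift A)›
  obtain ⟨K, hK⟩ : ∃ K, ∀ i, h i ≤ K := by
    have : Nonempty ι := ⟨coord 0 x₀⟩
    obtain ⟨i, hi⟩ := Finite.exists_max h
    exact ⟨h i, hi⟩
  have hnorm : ∀ n, ‖transferCLM f ^ n‖ ≤ K / δ := fun n => by
    have hK0 : 0 ≤ K := hδ.le.trans ((hle (coord 0 x₀)).trans (hK _))
    refine ContinuousLinearMap.opNorm_le_bound _ (by positivity) fun w => ?_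
    rw [ContinuousMap.norm_le _ (by positivity)]
    intro x
    calc _ ≤ ‖w‖ / δ * h (coord 0 x) := H.norm_pow_transferCLM_apply_le hδ hle w n x
      _ ≤ ‖w‖ / δ * K := by gcongr; exact hK _
      _ = K / δ * ‖w‖ := by ring
  -- The complexified eigenfunction puts `1` in the spectrum and gives the lower bound.
  set w : C(Subshift A, ℂ) :=
    ⟨fun x => (h (coord 0 x) : ℂ), Complex.continuous_ofReal.comp (letterFun A h).continuous⟩
    with hw
  have hw0 : w ≠ 0 := fun h0 => by
    have := DFunLike.congr_fun h0 x₀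
    simp only [hw, ContinuousMap.coe_mk, ContinuousMap.zero_apply, Complex.ofReal_eq_zero] at this
    exact (H.left_pos _).ne' this
  have hTw : transferCLM f w = w := by
    ext x
    have h1 := transfer_letterFun H.exp_eq H.vecMul_left x
    show transfer f w x = ((h (coord 0 x) : ℝ) : ℂ)
    rw [← h1]
    simp only [transfer, Complex.ofReal_sum]
    refine Finset.sum_congr rfl fun i _ => ?_
    split_ifs <;> simp [hw]
  have hle1 := spectralRadius_le_one_of_norm_pow_le
    (B := C(Subshift A, ℂ) →L[ℂ] C(Subshift A, ℂ)) (a := transferCLM f) hnorm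
  have hge1 := one_le_spectralRadius_of_apply_eq hw0 hTw
  rw [pressure, le_antisymm hle1 hge1]
  simp

/-- The normalisation of a fixed probability measure of the dual transfer operator. -/
theorem isEquilibriumState_iff [Nonempty (Subshift A)] {m : Measure (Subshift A)} :
    IsEquilibriumState f m ↔ ∃ μ : Measure (Subshift A), IsProbabilityMeasure μ ∧
      (∀ φ : C(Subshift A, ℝ), ∫ x, transfer f φ x ∂μ = ∫ x, φ x ∂μ) ∧
      m = μ.withDensity fun x => ENNReal.ofReal (h (coord 0 x) / ∫ z, h (coord 0 z) ∂μ) := by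
  constructor
  · rintro ⟨hP, v, μ, hv, hLv, hμ, hLμ, hm⟩
    simp only [hP, Real.exp_zero, one_mul] at hLv hLμ
    refine ⟨μ, hμ, hLμ, ?_⟩
    -- The eigenfunction is known up to a factor, which cancels in the normalised density.
    obtain ⟨c, hc⟩ := exists_eq_mul_of_transfer_eq H.exp_eq H.pred_closed H.pos H.left_pos
      H.vecMul_left hLv
    obtain ⟨x₀⟩ := ‹Nonempty (Subshift A)›
    have hc0 : c ≠ 0 := fun h0 => by
      have := hv x₀
      rw [hc, h0, zero_mul] at this
      exact this.false
    rw [hm]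
    congr 1
    funext x
    simp only [hc]
    rw [integral_const_mul, mul_div_mul_left _ _ hc0]
  · rintro ⟨μ, hμ, hLμ, rfl⟩
    refine ⟨H.pressure_eq_zero, letterFun A h, μ, fun x => H.left_pos _, fun x => ?_, hμ,
      fun φ => ?_, rfl⟩
    · rw [H.pressure_eq_zero, Real.exp_zero, one_mul, transfer_letterFun H.exp_eq H.vecMul_left,
        letterFun_apply]
    · rw [H.pressure_eq_zero, Real.exp_zero, one_mul, hLμ]

theorem existsUnique_isEquilibriumState [Nonempty (Subshift A)] :
    ∃! m : Measure (Subshift A), IsEquilibriumState f m := by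
  obtain ⟨μ, hμ, hLμ⟩ := exists_measure_integral_transfer_eq H.exp_eq H.left_pos H.vecMul_left
  refine ⟨_, H.isEquilibriumState_iff.2 ⟨μ, hμ, hLμ, rfl⟩, fun m hm => ?_⟩
  obtain ⟨ν, hν, hLν, rfl⟩ := H.isEquilibriumState_iff.1 hm
  rw [measure_eq_of_integral_transfer_eq H.exp_eq H.eq_of_sum_eq_one hLν hLμ]

end IsPerron

/-! ### Letter distribution and variance under the equilibrium state -/

section EquilibriumState

variable {f : C(Subshift A, ℝ)} {t h ρ : ι → ℝ} {m : Measure (Subshift A)}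

theorem IsEquilibriumState.exists_integral_eq [Nonempty (Subshift A)]
    (hm : IsEquilibriumState f m) (H : IsPerron f t h ρ) :
    ∃ μ : Measure (Subshift A), IsProbabilityMeasure μ ∧
      (∀ φ : C(Subshift A, ℝ), ∫ x, transfer f φ x ∂μ = ∫ x, φ x ∂μ) ∧
      0 < ∫ z, h (coord 0 z) ∂μ ∧ IsProbabilityMeasure m ∧
      ∀ g : Subshift A → ℝ,
        ∫ x, g x ∂m = (∫ z, h (coord 0 z) ∂μ)⁻¹ * ∫ x, g x * h (coord 0 x) ∂μ := by
  obtain ⟨μ, hμ, hLμ, rfl⟩ := H.isEquilibriumState_iff.1 hm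
  have hint : ∀ φ : C(Subshift A, ℝ), Integrable φ μ := fun φ =>
    (BoundedContinuousFunction.mkOfCompact φ).integrable μ
  have hZ : 0 < ∫ z, h (coord 0 z) ∂μ := by
    obtain ⟨δ, hδ, hle⟩ := H.exists_le_left
    calc 0 < δ := hδ
      _ = ∫ _z, δ ∂μ := by simp
      _ ≤ ∫ z, letterFun A h z ∂μ :=
        integral_mono (integrable_const _) (hint _) fun x => hle (coord 0 x)
  have hmeas : Measurable fun x : Subshift A =>
      ENNReal.ofReal (h (coord 0 x) / ∫ z, h (coord 0 z) ∂μ) :=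
    ((letterFun A h).continuous.div_const _).measurable.ennreal_ofReal
  have hi : Integrable (fun x => h (coord 0 x) / ∫ z, h (coord 0 z) ∂μ) μ :=
    (hint (letterFun A h)).div_const _
  refine ⟨μ, hμ, hLμ, hZ, ⟨?_⟩, fun g => ?_⟩
  · rw [withDensity_apply _ MeasurableSet.univ, Measure.restrict_univ,
      ← ofReal_integral_eq_lintegral_ofReal hi
        (Eventually.of_forall fun x => div_nonneg (H.left_pos _).le hZ.le), integral_div]
    simp [hZ.ne']
  · rw [integral_withDensity_eq_integral_toReal_smul hmeas
      (Eventually.of_forall fun x => ENNReal.ofReal_lt_top), ← integral_const_mul]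
    refine integral_congr_ae (Eventually.of_forall fun x => ?_)
    simp only [smul_eq_mul]
    rw [ENNReal.toReal_ofReal (div_nonneg (H.left_pos _).le hZ.le)]
    ring

theorem IsEquilibriumState.isProbabilityMeasure [Nonempty (Subshift A)]
    (hm : IsEquilibriumState f m) (H : IsPerron f t h ρ) : IsProbabilityMeasure m :=
  (hm.exists_integral_eq H).choose_spec.2.2.2.1

/-- The distribution of the zeroth letter under the equilibrium state. -/
theorem IsEquilibriumState.integral_letter [Nonempty (Subshift A)]
    (hm : IsEquilibriumState f m) (H : IsPerron f t h ρ) (w : ι → ℝ) :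
    ∫ x, w (coord 0 x) ∂m = (∑ i, w i * (h i * ρ i)) / ∑ i, h i * ρ i := by
  obtain ⟨μ, hμ, hLμ, hZ, -, hint⟩ := hm.exists_integral_eq H
  -- The letter masses of `μ` are proportional to `ρ`; the density `h` turns them into `h ρ`, and
  -- the factor `c` cancels.
  obtain ⟨c, hc⟩ := H.exists_eq_smul_right (measureReal_letter H.exp_eq hLμ)
  have hsum : ∀ u : ι → ℝ, ∫ x, u (coord 0 x) ∂μ = c * ∑ i, u i * ρ i := fun u => by
    rw [Subshift.integral_letter, Finset.mul_sum]
    refine Finset.sum_congr rfl fun i _ => ?_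
    have := congrFun hc i
    simp only [Pi.smul_apply, smul_eq_mul] at this
    rw [this]
    ring
  rw [hint, hsum, hsum fun i => w i * h i]
  rw [hsum] at hZ
  have hc0 : c ≠ 0 := fun h0 => by simp [h0] at hZ
  have h0 : ∑ i, h i * ρ i ≠ 0 := fun h0 => by simp [h0] at hZ
  simp_rw [mul_assoc]
  field_simp

/-- The transfer operator normalised by its eigenfunction is the adjoint of the composition with
the shift. -/
theorem IsEquilibriumState.integral_shift_mul [Nonempty (Subshift A)]
    (hm : IsEquilibriumState f m) (H : IsPerron f t h ρ) {u g : ι → ℝ}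
    (hug : Matrix.vecMul (fun i => u i * h i) (letterMat A t) = fun i => g i * h i)
    {φ : Subshift A → ℝ} (hφ : Continuous φ) :
    ∫ x, φ (shift x) * u (coord 0 x) ∂m = ∫ x, φ x * g (coord 0 x) ∂m := by
  obtain ⟨μ, hμ, hLμ, -, -, hint⟩ := hm.exists_integral_eq H
  rw [hint, hint]
  congr 1
  -- The transfer operator sends this test function to `φ · g h`, by the pull-out identity and
  -- `hug`.
  have h1 := hLμ ⟨fun x => φ (shift x) * (u (coord 0 x) * h (coord 0 x)),
    (hφ.comp continuous_shift).mul (letterFun A fun i => u i * h i).continuous⟩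
  simp only [ContinuousMap.coe_mk] at h1
  simp_rw [mul_assoc]
  rw [← h1]
  refine integral_congr_ae (Eventually.of_forall fun x => ?_)
  have := transfer_letter_mul_shift H.exp_eq (fun i => u i * h i) φ x
  simp only
  rw [this, hug]

theorem IsEquilibriumState.integral_shift [Nonempty (Subshift A)]
    (hm : IsEquilibriumState f m) (H : IsPerron f t h ρ) {φ : Subshift A → ℝ}
    (hφ : Continuous φ) : ∫ x, φ (shift x) ∂m = ∫ x, φ x ∂m := by
  have := hm.integral_shift_mul H (u := 1) (g := 1) (by simpa using H.vecMul_left) hφ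
  simpa using this

/-- If `φ = u - g` with `g` the image of `u` under the normalised transfer operator, then the
variance of `φ` is `∫ (u² - g²) dm`. -/
theorem IsEquilibriumState.hasVariance [Nonempty (Subshift A)]
    (hm : IsEquilibriumState f m) (H : IsPerron f t h ρ) {u g : ι → ℝ}
    (hug : Matrix.vecMul (fun i => u i * h i) (letterMat A t) = fun i => g i * h i) :
    HasVariance (letterFun A (u - g)) m (∫ x, (u (coord 0 x) ^ 2 - g (coord 0 x) ^ 2) ∂m) := by
  have hprob := hm.isProbabilityMeasure H
  have hI : ∀ φ : Subshift A → ℝ, Continuous φ → Integrable φ m := fun φ hφ =>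
    (BoundedContinuousFunction.mkOfCompact ⟨φ, hφ⟩).integrable m
  have cu : Continuous fun x : Subshift A => u (coord 0 x) := (letterFun A u).continuous
  have cg : Continuous fun x : Subshift A => g (coord 0 x) := (letterFun A g).continuous
  have cgs : ∀ n, Continuous fun x : Subshift A => g (coord n x) := fun n =>
    (continuous_of_discreteTopology (f := g)).comp (continuous_coord n)
  have cg' : Continuous fun x : Subshift A => g (coord 0 (shift x)) := cg.comp continuous_shift
  have hmean : ∫ x, letterFun A (u - g) x ∂m = 0 := by
    have h1 := hm.integral_shift_mul H hug (φ := fun _ => 1) continuous_const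
    simp only [one_mul] at h1
    simp only [letterFun_apply, Pi.sub_apply]
    rw [integral_sub (hI _ cu) (hI _ cg), h1, sub_self]
  -- The Birkhoff sum corrected by a bounded coboundary; this is the Birkhoff sum of `u - g ∘ σ`.
  set D : ℕ → Subshift A → ℝ := fun n x =>
    birkhoffSum shift (letterFun A (u - g)) n x + g (coord 0 x) - g (coord n x) with hD
  have cS : ∀ n, Continuous fun x => birkhoffSum shift (letterFun A (u - g)) n x := fun n =>
    continuous_finsetSum _ fun k _ =>
      (letterFun A (u - g)).continuous.comp (continuous_shift.iterate k)
  have cD : ∀ n, Continuous (D n) := fun n => ((cS n).fun_add cg).fun_sub (cgs n)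
  set V := ∫ x, (u (coord 0 x) ^ 2 - g (coord 0 x) ^ 2) ∂m with hV
  have hsucc : ∀ n x, D (n + 1) x = u (coord 0 x) - g (coord 0 (shift x)) + D n (shift x) := by
    intro n x
    simp only [hD, birkhoffSum_succ', letterFun_apply, Pi.sub_apply, coord_shift]
    ring
  have hM : ∫ x, (u (coord 0 x) - g (coord 0 (shift x))) ^ 2 ∂m = V := by
    have h1 := hm.integral_shift_mul H hug cg
    have h2 := hm.integral_shift H (cg.fun_pow 2)
    have e : ∀ x : Subshift A, (u (coord 0 x) - g (coord 0 (shift x))) ^ 2 =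
        u (coord 0 x) ^ 2 - 2 * (g (coord 0 (shift x)) * u (coord 0 x)) +
          g (coord 0 (shift x)) ^ 2 := fun x => by ring
    simp_rw [e]
    rw [integral_add (hI _ ((cu.fun_pow 2).fun_sub ((cg'.fun_mul cu).const_mul 2))) (hI _ (cg'.fun_pow 2)),
      integral_sub (hI _ (cu.fun_pow 2)) (hI _ ((cg'.fun_mul cu).const_mul 2)), integral_const_mul,
      h1, h2, hV, integral_sub (hI _ (cu.fun_pow 2)) (hI _ (cg.fun_pow 2))]
    simp_rw [← pow_two]
    ring
  -- Orthogonality of increments: the cross term is `∫ D n · g - ∫ D n · g = 0`, by duality for `u`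
  -- and by shift invariance for `g ∘ σ`.
  have hDV : ∀ n : ℕ, ∫ x, D n x ^ 2 ∂m = n * V := by
    intro n
    induction n with
    | zero => simp [hD]
    | succ n ih =>
      have h1 := hm.integral_shift_mul H hug (cD n)
      have h2 := hm.integral_shift H ((cD n).fun_mul cg)
      have h3 := hm.integral_shift H ((cD n).fun_pow 2)
      have cDs : Continuous fun x => D n (shift x) := (cD n).comp continuous_shift
      have cM : Continuous fun x : Subshift A => u (coord 0 x) - g (coord 0 (shift x)) :=
        cu.fun_sub cg'
      have e : ∀ x : Subshift A, D (n + 1) x ^ 2 =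
          (u (coord 0 x) - g (coord 0 (shift x))) ^ 2 +
          2 * (D n (shift x) * u (coord 0 x) - D n (shift x) * g (coord 0 (shift x))) +
          D n (shift x) ^ 2 := fun x => by rw [hsucc]; ring
      simp_rw [e]
      rw [integral_add (hI _ ((cM.fun_pow 2).fun_add
          (((cDs.fun_mul cu).fun_sub (cDs.fun_mul cg')).const_mul 2))) (hI _ (cDs.fun_pow 2)),
        integral_add (hI _ (cM.fun_pow 2)) (hI _ (((cDs.fun_mul cu).fun_sub (cDs.fun_mul cg')).const_mul 2)),
        integral_const_mul, integral_sub (hI _ (cDs.fun_mul cu)) (hI _ (cDs.fun_mul cg')), hM, h1, h2,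
        h3, ih]
      push_cast
      ring
  obtain ⟨K, hK⟩ : ∃ K, ∀ i, |g i| ≤ K := by
    rcases isEmpty_or_nonempty ι with hι | hι
    · exact ⟨0, fun i => hι.elim i⟩
    · obtain ⟨i, hi⟩ := Finite.exists_max fun i => |g i|
      exact ⟨_, hi⟩
  -- The coboundary has size at most `2K`. Weighting the cross term `2 D b` by `r = √n` bounds the
  -- error before division by `n` by `nV / r + 8K² r`, which is of order `√n`.
  have hb : ∀ n : ℕ, 0 < n →
      |(1 / (n : ℝ)) * (∫ x, birkhoffSum shift (letterFun A (u - g)) n x ^ 2 ∂m) - V| ≤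
        (V + 8 * K ^ 2) * (1 / √(n : ℝ)) := by
    intro n hn
    have hn' : (0 : ℝ) < n := by exact_mod_cast hn
    have hn1 : (1 : ℝ) ≤ n := by exact_mod_cast hn
    set r := √(n : ℝ) with hr
    have hr1 : 1 ≤ r := by rw [hr]; exact Real.one_le_sqrt.2 hn1
    have hrr : r * r = n := Real.mul_self_sqrt hn'.le
    have hpt : ∀ x, |birkhoffSum shift (letterFun A (u - g)) n x ^ 2 - D n x ^ 2| ≤
        D n x ^ 2 * (1 / r) + 8 * K ^ 2 * r := by
      intro x
      have h1 : birkhoffSum shift (letterFun A (u - g)) n x =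
          D n x + (g (coord n x) - g (coord 0 x)) := by simp only [hD]; ring
      set b := g (coord n x) - g (coord 0 x) with hb
      have hbK : b ^ 2 ≤ 4 * K ^ 2 := by
        have h2 : |b| ≤ 2 * K := (abs_sub _ _).trans (by linarith [hK (coord n x), hK (coord 0 x)])
        calc b ^ 2 = |b| ^ 2 := (sq_abs b).symm
          _ ≤ (2 * K) ^ 2 := by gcongr
          _ = _ := by ring
      have h3 : |2 * (D n x * b)| ≤ D n x ^ 2 * (1 / r) + b ^ 2 * r := by
        rw [abs_mul, abs_two, abs_mul, ← sq_abs (D n x), ← sq_abs b]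
        have h4 := sq_nonneg (|D n x| - r * |b|)
        have hr0 : 0 < r := by linarith
        rw [mul_one_div, ← sub_nonneg]
        have : |D n x| ^ 2 / r + |b| ^ 2 * r - 2 * (|D n x| * |b|) =
            (|D n x| - r * |b|) ^ 2 / r := by field_simp; ring
        rw [this]
        positivity
      rw [h1]
      calc |(D n x + b) ^ 2 - D n x ^ 2| = |2 * (D n x * b) + b ^ 2| := by ring_nf
        _ ≤ |2 * (D n x * b)| + |b ^ 2| := abs_add_le _ _
        _ ≤ D n x ^ 2 * (1 / r) + b ^ 2 * r + b ^ 2 * r := by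
          rw [abs_of_nonneg (sq_nonneg b)]
          nlinarith [sq_nonneg b]
        _ ≤ _ := by nlinarith
    have hint : |(∫ x, birkhoffSum shift (letterFun A (u - g)) n x ^ 2 ∂m) - n * V| ≤
        n * V * (1 / r) + 8 * K ^ 2 * r := by
      rw [← hDV n, ← integral_sub (hI _ ((cS n).fun_pow 2)) (hI _ ((cD n).fun_pow 2))]
      calc _ ≤ ∫ x, |birkhoffSum shift (letterFun A (u - g)) n x ^ 2 - D n x ^ 2| ∂m :=
            abs_integral_le_integral_abs
        _ ≤ ∫ x, (D n x ^ 2 * (1 / r) + 8 * K ^ 2 * r) ∂m :=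
            integral_mono (hI _ (((cS n).fun_pow 2).fun_sub ((cD n).fun_pow 2)).abs)
              (hI _ ((((cD n).fun_pow 2).mul_const _).fun_add continuous_const)) hpt
        _ = _ := by
            rw [integral_add (hI _ (((cD n).fun_pow 2).mul_const _)) (integrable_const _),
              integral_mul_const]
            simp
    have e : (1 / (n : ℝ)) * (∫ x, birkhoffSum shift (letterFun A (u - g)) n x ^ 2 ∂m) - V =
        (1 / (n : ℝ)) * ((∫ x, birkhoffSum shift (letterFun A (u - g)) n x ^ 2 ∂m) - n * V) := by
      field_simp
    rw [e, abs_mul, abs_of_pos (by positivity : (0 : ℝ) < 1 / n)]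
    calc _ ≤ (1 / (n : ℝ)) * (n * V * (1 / r) + 8 * K ^ 2 * r) := by gcongr
      _ = _ := by
        rw [← hrr]
        have : r ≠ 0 := by linarith
        field_simp
  rw [HasVariance, hmean]
  simp only [mul_zero, sub_zero]
  rw [tendsto_iff_norm_sub_tendsto_zero]
  have hlim : Tendsto (fun n : ℕ => (V + 8 * K ^ 2) * (1 / √(n : ℝ))) atTop (𝓝 0) := by
    have : Tendsto (fun n : ℕ => (√(n : ℝ))⁻¹) atTop (𝓝 0) :=
      tendsto_inv_atTop_zero.comp (Real.tendsto_sqrt_atTop.comp tendsto_natCast_atTop_atTop)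
    simpa using this.const_mul (V + 8 * K ^ 2)
  refine squeeze_zero' (Eventually.of_forall fun n => norm_nonneg _) ?_ hlim
  filter_upwards [eventually_gt_atTop 0] with n hn
  exact hb n hn

end EquilibriumState

end Subshift

/-! ### Counting admissible paths by length -/

section Paths

variable {ι : Type*} {A : Matrix ι ι ℕ} {ℓ : ι → ℝ}

/-- The admissible words from `i` to `j` whose letters but the last have total length less than
`T`. -/
def pathSet (A : Matrix ι ι ℕ) (ℓ : ι → ℝ) (i j : ι) (T : ℝ) : Set (List ι) :=
  {γ | γ.IsChain (fun d d' => A d d' = 1) ∧ γ.head? = some i ∧ γ.getLast? = some j ∧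
    (γ.dropLast.map ℓ).sum < T}

/-- The renewal decomposition by the first letter. The last letter carries no length, so a
one-letter word has length zero and counts once `0 < T`. -/
theorem cons_mem_pathSet {i i' j : ι} {γ : List ι} {T : ℝ} :
    i' :: γ ∈ pathSet A ℓ i j T ↔ i' = i ∧
      ((γ = [] ∧ i = j ∧ 0 < T) ∨ ∃ k, A i k = 1 ∧ γ ∈ pathSet A ℓ k j (T - ℓ i)) := by
  cases γ with
  | nil =>
    simp only [pathSet, Set.mem_ofPred_eq]
    constructor
    · rintro ⟨-, h1, h2, h3⟩
      simp_all
    · rintro ⟨rfl, h | ⟨k, -, -, h, -⟩⟩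
      · simpa using h.2
      · simp at h
  | cons k γ =>
    simp only [pathSet, Set.mem_ofPred_eq, List.isChain_cons_cons, List.head?_cons,
      Option.some.injEq, List.getLast?_cons_cons, List.dropLast_cons_cons, List.map_cons,
      List.sum_cons]
    constructor
    · rintro ⟨⟨h1, h2⟩, rfl, h3, h4⟩
      exact ⟨rfl, Or.inr ⟨k, h1, h2, rfl, h3, by linarith⟩⟩
    · rintro ⟨rfl, h | ⟨k', h1, h2, rfl, h3, h4⟩⟩
      · simp at h
      · exact ⟨⟨h1, h2⟩, rfl, h3, by linarith⟩

theorem length_mul_le_sum {a : ℝ} (ha : ∀ i, a ≤ ℓ i) (γ : List ι) :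
    γ.length * a ≤ (γ.map ℓ).sum := by
  induction γ with
  | nil => simp
  | cons i γ ih =>
    simp only [List.length_cons, List.map_cons, List.sum_cons, Nat.cast_add, Nat.cast_one]
    linarith [ha i]

variable [Finite ι]

theorem exists_pos_le (hℓ : ∀ i, 0 < ℓ i) : ∃ a > 0, ∀ i, a ≤ ℓ i := by
  rcases isEmpty_or_nonempty ι with h | h
  · exact ⟨1, one_pos, fun i => h.elim i⟩
  · obtain ⟨i, hi⟩ := Finite.exists_min ℓ
    exact ⟨ℓ i, hℓ i, hi⟩

theorem exists_pos_ge (ℓ : ι → ℝ) : ∃ b > 0, ∀ i, ℓ i ≤ b := by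
  rcases isEmpty_or_nonempty ι with h | h
  · exact ⟨1, one_pos, fun i => h.elim i⟩
  · obtain ⟨i, hi⟩ := Finite.exists_max ℓ
    exact ⟨max 1 (ℓ i), by positivity, fun j => (hi j).trans (le_max_right _ _)⟩

theorem finite_setOf_sum_lt (hℓ : ∀ i, 0 < ℓ i) (T : ℝ) :
    {γ : List ι | (γ.dropLast.map ℓ).sum < T}.Finite := by
  obtain ⟨a, ha, hle⟩ := exists_pos_le hℓ
  obtain ⟨n, hn⟩ := exists_nat_gt (T / a)
  refine (List.finite_length_le ι n).subset fun γ hγ => ?_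
  have h1 : (γ.dropLast.length : ℝ) * a < n * a := by
    rw [div_lt_iff₀ ha] at hn
    exact ((length_mul_le_sum hle _).trans_lt hγ).trans hn
  have h2 : γ.dropLast.length < n := by exact_mod_cast lt_of_mul_lt_mul_right h1 ha.le
  rw [List.length_dropLast] at h2
  show γ.length ≤ n
  omega

theorem finite_pathSet (hℓ : ∀ i, 0 < ℓ i) (i j : ι) (T : ℝ) : (pathSet A ℓ i j T).Finite :=
  (finite_setOf_sum_lt hℓ T).subset fun _ hγ => hγ.2.2.2

theorem pathSet_eq_empty (hℓ : ∀ i, 0 < ℓ i) (i j : ι) {T : ℝ} (hT : T ≤ 0) :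
    pathSet A ℓ i j T = ∅ := by
  refine Set.eq_empty_of_forall_notMem fun γ hγ => ?_
  have h1 := length_mul_le_sum (a := 0) (fun i => (hℓ i).le) γ.dropLast
  have h2 := hγ.2.2.2
  linarith

end Paths

/-! ### Exponential growth of the number of paths -/

section Count

variable {ι : Type*} [Fintype ι] {A : Matrix ι ι ℕ} {ℓ : ι → ℝ}

theorem ncard_iUnion_pathSet (hℓ : ∀ i, 0 < ℓ i) (i j : ι) (T : ℝ) :
    ((⋃ k, {γ | A i k = 1 ∧ γ ∈ pathSet A ℓ k j (T - ℓ i)}).ncard : ℝ) =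
      ∑ k, Subshift.letterMat A 1 i k * ((pathSet A ℓ k j (T - ℓ i)).ncard : ℝ) := by
  rw [Set.ncard_iUnion_of_finite, finsum_eq_sum_of_fintype]
  · push_cast
    refine Finset.sum_congr rfl fun k _ => ?_
    by_cases h : A i k = 1
    · simp [Subshift.letterMat_of_eq h, h]
    · simp [Subshift.letterMat_of_ne h, h]
  · exact fun k => (finite_pathSet hℓ k j _).subset fun γ hγ => hγ.2
  · intro k k' hkk'
    refine Set.disjoint_left.2 fun γ hγ hγ' => hkk' ?_
    have := hγ.2.2.1.symm.trans hγ'.2.2.1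
    simpa using this

theorem sum_ncard_pathSet_le (hℓ : ∀ i, 0 < ℓ i) (i j : ι) (T : ℝ) :
    ∑ k, Subshift.letterMat A 1 i k * ((pathSet A ℓ k j (T - ℓ i)).ncard : ℝ) ≤
      (pathSet A ℓ i j T).ncard := by
  rw [← ncard_iUnion_pathSet hℓ,
    ← Set.ncard_image_of_injective _ (List.cons_injective (a := i))]
  norm_cast
  refine Set.ncard_le_ncard ?_ (finite_pathSet hℓ i j T)
  rintro _ ⟨γ, hγ, rfl⟩
  obtain ⟨k, hk⟩ := Set.mem_iUnion.1 hγ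
  exact cons_mem_pathSet.2 ⟨rfl, Or.inr ⟨k, hk⟩⟩

/-- The only path that does not arise by prefixing `i` to a path from a successor is `[i]`, whence
the `+ 1`. -/
theorem ncard_pathSet_le (hℓ : ∀ i, 0 < ℓ i) (i j : ι) (T : ℝ) :
    ((pathSet A ℓ i j T).ncard : ℝ) ≤
      (∑ k, Subshift.letterMat A 1 i k * ((pathSet A ℓ k j (T - ℓ i)).ncard : ℝ)) + 1 := by
  rw [← ncard_iUnion_pathSet hℓ,
    ← Set.ncard_image_of_injective
      (⋃ k, {γ | A i k = 1 ∧ γ ∈ pathSet A ℓ k j (T - ℓ i)}) (List.cons_injective (a := i))]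
  norm_cast
  have hfin : (⋃ k, {γ | A i k = 1 ∧ γ ∈ pathSet A ℓ k j (T - ℓ i)}).Finite :=
    Set.finite_iUnion fun k => (finite_pathSet hℓ k j _).subset fun γ hγ => hγ.2
  refine (Set.ncard_le_ncard (t := insert [i] (List.cons i ''
    (⋃ k, {γ | A i k = 1 ∧ γ ∈ pathSet A ℓ k j (T - ℓ i)}))) ?_
    ((hfin.image _).insert _)).trans (Set.ncard_insert_le _ _)
  intro γ hγ
  cases γ with
  | nil => simpa using hγ.2.1
  | cons i' γ =>
    obtain ⟨rfl, ⟨rfl, -⟩ | ⟨k, hk⟩⟩ := cons_mem_pathSet.1 hγ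
    · exact Set.mem_insert _ _
    · exact Set.mem_insert_of_mem _ ⟨γ, Set.mem_iUnion.2 ⟨k, hk⟩, rfl⟩

variable {δ : ℝ} {ρ : ι → ℝ}

/-- `ρ i * exp (δ T)` solves the renewal equation without its inhomogeneous term exactly; it is the
comparison function for both bounds. -/
theorem sum_letterMat_one_mul
    (hρ : (Subshift.letterMat A fun i => Real.exp (-(δ * ℓ i))).mulVec ρ = ρ) (i : ι) (T : ℝ) :
    ∑ k, Subshift.letterMat A 1 i k * (ρ k * Real.exp (δ * (T - ℓ i))) =
      ρ i * Real.exp (δ * T) := by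
  have h1 := congrFun hρ i
  simp only [Matrix.mulVec, dotProduct] at h1
  rw [← h1, Finset.sum_mul]
  refine Finset.sum_congr rfl fun k _ => ?_
  have h2 : Real.exp (δ * (T - ℓ i)) = Real.exp (-(δ * ℓ i)) * Real.exp (δ * T) := by
    rw [← Real.exp_add]; ring_nf
  rw [h2]
  by_cases h : A i k = 1
  · rw [Subshift.letterMat_of_eq h, Subshift.letterMat_of_eq h, Pi.one_apply]; ring
  · rw [Subshift.letterMat_of_ne h, Subshift.letterMat_of_ne h]; ring

theorem letterMat_one_nonneg (i k : ι) : 0 ≤ Subshift.letterMat A 1 i k := by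
  by_cases h : A i k = 1
  · rw [Subshift.letterMat_of_eq h]; exact zero_le_one
  · rw [Subshift.letterMat_of_ne h]

theorem exists_ncard_pathSet_le (hℓ : ∀ i, 0 < ℓ i) (hδ : 0 ≤ δ) (hpos : ∀ i, 0 < ρ i)
    (hρ : (Subshift.letterMat A fun i => Real.exp (-(δ * ℓ i))).mulVec ρ = ρ)
    (hout : ∀ i, 2 ≤ ∑ k, Subshift.letterMat A 1 i k) :
    ∃ C > 0, ∀ i j T, 0 ≤ T → ((pathSet A ℓ i j T).ncard : ℝ) ≤ C * Real.exp (δ * T) := by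
  obtain ⟨a, ha, hal⟩ := exists_pos_le hℓ
  obtain ⟨b, hb, hbl⟩ := exists_pos_ge ℓ
  obtain ⟨r, hr, hrl⟩ := exists_pos_le hpos
  obtain ⟨R, hR, hRl⟩ := exists_pos_ge ρ
  -- Chosen so that `C r e^{-δb} = 1`: the bound then holds on `[-b, 0]`, where there are no paths
  -- and where one step back from `T ≥ 0` can land.
  set C := Real.exp (δ * b) / r with hC
  have hC0 : 0 < C := by positivity
  -- The `- 1` absorbs the inhomogeneous term: at least two successors contribute `-2`, and `-2 + 1
  -- ≤ -1`. Each step back reduces `T` by at least `a`, so induction on `n` reaches every `T`.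
  have key : ∀ (n : ℕ) (i j : ι) (T : ℝ), T ≤ n * a → -b ≤ T →
      ((pathSet A ℓ i j T).ncard : ℝ) ≤ C * (ρ i * Real.exp (δ * T)) - 1 := by
    have hbase : ∀ (i j : ι) (T : ℝ), T ≤ 0 → -b ≤ T →
        ((pathSet A ℓ i j T).ncard : ℝ) ≤ C * (ρ i * Real.exp (δ * T)) - 1 := by
      intro i j T hT hT'
      rw [pathSet_eq_empty hℓ i j hT, Set.ncard_empty, Nat.cast_zero, sub_nonneg]
      calc 1 = C * (r * Real.exp (-(δ * b))) := by
            rw [hC, Real.exp_neg]; field_simp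
        _ ≤ C * (ρ i * Real.exp (δ * T)) := by
            gcongr
            · exact (hpos i).le
            · exact hrl i
            · nlinarith
    intro n
    induction n with
    | zero => exact fun i j T hT => hbase i j T (by simpa using hT)
    | succ n ih =>
      intro i j T hT hT'
      rcases le_total T 0 with h0 | h0
      · exact hbase i j T h0 hT'
      refine (ncard_pathSet_le hℓ i j T).trans ?_
      have h1 : ∑ k, Subshift.letterMat A 1 i k * ((pathSet A ℓ k j (T - ℓ i)).ncard : ℝ) ≤
          ∑ k, Subshift.letterMat A 1 i k * (C * (ρ k * Real.exp (δ * (T - ℓ i))) - 1) := by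
        refine Finset.sum_le_sum fun k _ =>
          mul_le_mul_of_nonneg_left (ih k j _ ?_ ?_) (letterMat_one_nonneg i k)
        · push_cast at hT
          linarith [hal i]
        · linarith [hbl i]
      have h2 : ∑ k, Subshift.letterMat A 1 i k * (C * (ρ k * Real.exp (δ * (T - ℓ i))) - 1) =
          C * (ρ i * Real.exp (δ * T)) - ∑ k, Subshift.letterMat A 1 i k := by
        rw [← sum_letterMat_one_mul hρ i T, Finset.mul_sum, ← Finset.sum_sub_distrib]
        exact Finset.sum_congr rfl fun k _ => by ring
      linarith [hout i]
  refine ⟨C * R, by positivity, fun i j T hT => ?_⟩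
  obtain ⟨n, hn⟩ := exists_nat_gt (T / a)
  have h1 := key n i j T ((div_lt_iff₀ ha).1 hn).le (by linarith)
  calc _ ≤ C * (ρ i * Real.exp (δ * T)) := by linarith
    _ ≤ C * (R * Real.exp (δ * T)) := by gcongr; exact hRl i
    _ = _ := by ring

theorem exists_le_ncard_pathSet (hℓ : ∀ i, 0 < ℓ i) (hδ : 0 ≤ δ) (hpos : ∀ i, 0 < ρ i)
    (hρ : (Subshift.letterMat A fun i => Real.exp (-(δ * ℓ i))).mulVec ρ = ρ) (j : ι)
    (hconn : ∀ i, ∃ T, (pathSet A ℓ i j T).Nonempty) :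
    ∃ c > 0, ∃ T₀, ∀ i T, T₀ ≤ T → c * Real.exp (δ * T) ≤ ((pathSet A ℓ i j T).ncard : ℝ) := by
  obtain ⟨a, ha, hal⟩ := exists_pos_le hℓ
  obtain ⟨b, hb, hbl⟩ := exists_pos_ge ℓ
  obtain ⟨r, hr, hrl⟩ := exists_pos_le hpos
  obtain ⟨R, hR, hRl⟩ := exists_pos_ge ρ
  choose τ hτ using hconn
  obtain ⟨T₀, -, hT₀⟩ := exists_pos_ge τ
  have hone : ∀ i T, T₀ ≤ T → (1 : ℝ) ≤ (pathSet A ℓ i j T).ncard := by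
    intro i T hT
    obtain ⟨γ, hγ⟩ := hτ i
    have : 0 < (pathSet A ℓ i j T).ncard := (Set.ncard_pos (finite_pathSet hℓ i j T)).2
      ⟨γ, hγ.1, hγ.2.1, hγ.2.2.1, hγ.2.2.2.trans_le ((hT₀ i).trans hT)⟩
    exact_mod_cast this
  -- Makes the comparison function at most `1` on the window `[T₀, T₀ + b]`, where at least one path
  -- exists; a step back from beyond the window stays above `T₀`.
  set c := (R * Real.exp (δ * (T₀ + b)))⁻¹ with hc
  have hc0 : 0 < c := by positivity
  have key : ∀ (n : ℕ) (i : ι) (T : ℝ), T₀ ≤ T → T ≤ T₀ + b + n * a →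
      c * (ρ i * Real.exp (δ * T)) ≤ ((pathSet A ℓ i j T).ncard : ℝ) := by
    have hbase : ∀ (i : ι) (T : ℝ), T₀ ≤ T → T ≤ T₀ + b →
        c * (ρ i * Real.exp (δ * T)) ≤ ((pathSet A ℓ i j T).ncard : ℝ) := by
      intro i T hT hT'
      refine le_trans ?_ (hone i T hT)
      calc c * (ρ i * Real.exp (δ * T)) ≤ c * (R * Real.exp (δ * (T₀ + b))) := by
            gcongr
            exact hRl i
        _ = 1 := by rw [hc]; field_simp
    intro n
    induction n with
    | zero => exact fun i T hT hT' => hbase i T hT (by simpa using hT')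
    | succ n ih =>
      intro i T hT hT'
      rcases le_total T (T₀ + b) with h0 | h0
      · exact hbase i T hT h0
      refine le_trans ?_ (sum_ncard_pathSet_le hℓ i j T)
      rw [← sum_letterMat_one_mul hρ i T, Finset.mul_sum]
      refine Finset.sum_le_sum fun k _ => ?_
      rw [mul_left_comm]
      refine mul_le_mul_of_nonneg_left (ih k _ ?_ ?_) (letterMat_one_nonneg i k)
      · linarith [hbl i]
      · push_cast at hT'
        linarith [hal i]
  refine ⟨c * r, by positivity, T₀, fun i T hT => ?_⟩
  obtain ⟨n, hn⟩ := exists_nat_gt ((T - (T₀ + b)) / a)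
  have h1 := key n i T hT (by linarith [(div_lt_iff₀ ha).1 hn])
  calc c * r * Real.exp (δ * T) = c * (r * Real.exp (δ * T)) := by ring
    _ ≤ c * (ρ i * Real.exp (δ * T)) := by gcongr; exact hrl i
    _ ≤ _ := h1

end Count

theorem tendsto_one_div_mul_log_of_le {N : ℝ → ℝ} {c C δ T₀ : ℝ} (hc : 0 < c) (hC : 0 < C)
    (hN : ∀ T ≥ T₀, c * Real.exp (δ * T) ≤ N T) (hN' : ∀ T ≥ T₀, N T ≤ C * Real.exp (δ * T)) :
    Tendsto (fun T => (1 / T) * Real.log (N T)) atTop (𝓝 δ) := by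
  have hlim : ∀ a : ℝ, Tendsto (fun T : ℝ => (1 / T) * Real.log a + δ) atTop (𝓝 δ) := fun a => by
    have h1 : Tendsto (fun T : ℝ => T⁻¹ * Real.log a + δ) atTop (𝓝 (0 * Real.log a + δ)) :=
      (tendsto_inv_atTop_zero.mul_const _).add_const _
    simpa using h1
  have hlog : ∀ a T : ℝ, 0 < a → 0 < T →
      (1 / T) * Real.log (a * Real.exp (δ * T)) = (1 / T) * Real.log a + δ := fun a T ha hT => by
    rw [Real.log_mul ha.ne' (Real.exp_pos _).ne', Real.log_exp]
    field_simp
  refine tendsto_of_tendsto_of_tendsto_of_le_of_le' (hlim c) (hlim C) ?_ ?_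
  · filter_upwards [eventually_ge_atTop T₀, eventually_gt_atTop 0] with T hT hT0
    rw [← hlog c T hc hT0]
    have := hN T hT
    gcongr
  · filter_upwards [eventually_ge_atTop T₀, eventually_gt_atTop 0] with T hT hT0
    rw [← hlog C T hC hT0]
    have h1 := hN T hT
    have h2 := hN' T hT
    have h3 : 0 < N T := lt_of_lt_of_le (by positivity) h1
    gcongr

/-! ### Entropy of a metric graph -/

namespace MultiGraph

variable {V E : Type*} [DecidableEq V] [DecidableEq E] [Fintype E]

/-- The entropy of a metric graph is the exponent `δ` for which the matrix
`A(i, j) e^{-δ l(i)}` has the eigenvalue `1` with a positive eigenvector. -/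
theorem hasEntropy_of_mulVec_eq {G : MultiGraph V E} {l : E → ℝ} (hl : ∀ e, 0 < l e) {δ : ℝ}
    (hδ : 0 ≤ δ) {ρ : G.DirEdge → ℝ} (hpos : ∀ i, 0 < ρ i)
    (hρ : (Subshift.letterMat G.adjMat fun i => Real.exp (-(δ * l i.1))).mulVec ρ = ρ)
    (hout : ∀ i, 2 ≤ ∑ k, Subshift.letterMat G.adjMat 1 i k)
    (hconn : ∀ i j, ∃ γ : List G.DirEdge, γ.IsChain (fun d d' => G.adjMat d d' = 1) ∧
      γ.head? = some i ∧ γ.getLast? = some j) {i₀ k₀ : G.DirEdge} (hA : G.adjMat i₀ k₀ = 1) :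
    G.HasEntropy l δ := by
  have hℓ : ∀ i : G.DirEdge, 0 < l i.1 := fun i => hl i.1
  obtain ⟨C, hC, hupper⟩ := exists_ncard_pathSet_le hℓ hδ hpos hρ hout
  obtain ⟨c, hc, T₀, hlower⟩ := exists_le_ncard_pathSet hℓ hδ hpos hρ i₀ fun i => by
    obtain ⟨γ, h1, h2, h3⟩ := hconn i i₀
    exact ⟨_, γ, h1, h2, h3, lt_add_one _⟩
  have hcard : (0 : ℝ) < Fintype.card G.DirEdge := by
    have : Nonempty G.DirEdge := ⟨i₀⟩
    exact_mod_cast Fintype.card_pos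
  refine tendsto_one_div_mul_log_of_le (T₀ := max 0 (T₀ + l i₀.1))
    (c := c * Real.exp (-(δ * l i₀.1))) (C := Fintype.card G.DirEdge * C) (by positivity)
    (by positivity) (fun T hT => ?_) fun T hT => ?_
  -- Lower bound: prefixing `i₀` to the paths from `k₀` to `i₀` gives distinct closed cycles.
  · have hT' : T₀ ≤ T - l i₀.1 := by linarith [(le_max_right 0 (T₀ + l i₀.1)).trans hT]
    calc c * Real.exp (-(δ * l i₀.1)) * Real.exp (δ * T)
        = c * Real.exp (δ * (T - l i₀.1)) := by
          rw [mul_assoc, ← Real.exp_add]; ring_nf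
      _ ≤ _ := hlower k₀ _ hT'
      _ ≤ _ := by
        rw [← Set.ncard_image_of_injective _ (List.cons_injective (a := i₀))]
        norm_cast
        refine Set.ncard_le_ncard ?_ ((finite_setOf_sum_lt hℓ T).subset fun γ hγ => hγ.2)
        rintro _ ⟨γ, hγ, rfl⟩
        have h1 : i₀ :: γ ∈ pathSet G.adjMat (fun i : G.DirEdge => l i.1) i₀ i₀ T :=
          cons_mem_pathSet.2 ⟨rfl, Or.inr ⟨k₀, hA, hγ⟩⟩
        refine ⟨⟨?_, h1.1, h1.2.1.trans h1.2.2.1.symm⟩, h1.2.2.2⟩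
        cases γ with
        | nil => simpa using hγ.2.1
        | cons d γ => simp
  -- Upper bound: every closed cycle is a path from some letter to itself.
  · have hT0 : 0 ≤ T := (le_max_left 0 (T₀ + l i₀.1)).trans hT
    calc (({γ | G.IsClosedCycle γ ∧ G.cycleLength l γ < T}.ncard : ℕ) : ℝ)
        ≤ ((⋃ i, pathSet G.adjMat (fun i : G.DirEdge => l i.1) i i T).ncard : ℕ) := by
          norm_cast
          refine Set.ncard_le_ncard ?_ (Set.finite_iUnion fun i => finite_pathSet hℓ i i T)
          rintro γ ⟨⟨h1, h2, h3⟩, h4⟩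
          cases γ with
          | nil => simp at h1
          | cons i γ =>
            exact Set.mem_iUnion.2 ⟨i, h2, rfl, h3.symm, h4⟩
      _ ≤ ∑ i, ((pathSet G.adjMat (fun i : G.DirEdge => l i.1) i i T).ncard : ℝ) := by
          have := Set.ncard_iUnion_le_of_fintype
            fun i => pathSet G.adjMat (fun i : G.DirEdge => l i.1) i i T
          exact_mod_cast this
      _ ≤ ∑ _i : G.DirEdge, C * Real.exp (δ * T) :=
          Finset.sum_le_sum fun i _ => hupper i i T hT0
      _ = _ := by simp [mul_assoc]

end MultiGraph

/-! ### The stationary vector -/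

namespace MultiGraph

variable {V E : Type*} [DecidableEq V] [DecidableEq E] [Fintype E]

theorem weightedMat_eq_letterMat (G : MultiGraph V E) (l : E → ℝ) :
    G.weightedMat l = Subshift.letterMat G.adjMat fun i => Real.exp (-l i.1) := by
  ext i j
  by_cases h : G.adjMat i j = 1
  · rw [Subshift.letterMat_of_eq h, weightedMat, h, Nat.cast_one, one_mul]
  · have h0 : G.adjMat i j = 0 := by
      unfold adjMat at h ⊢
      split_ifs at h ⊢ <;> simp_all
    rw [Subshift.letterMat_of_ne h, weightedMat, h0, Nat.cast_zero, zero_mul]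

/-- The stochastic matrix is the weighted one conjugated by the diagonal matrix of `v`; hence `p` is
fixed exactly when `p / v` is a right eigenvector, and `p` is proportional to `h ρ`. -/
theorem stochMat_mulVec (G : MultiGraph V E) (l : E → ℝ) (v p : G.DirEdge → ℝ) (i : G.DirEdge) :
    (G.stochMat l v).mulVec p i = v i * (G.weightedMat l).mulVec (fun j => p j / v j) i := by
  simp only [Matrix.mulVec, dotProduct, stochMat, weightedMat, Finset.mul_sum]
  exact Finset.sum_congr rfl fun j _ => by ring

variable [TopologicalSpace E] [DiscreteTopology E]

theorem isStationaryVec_iff {G : MultiGraph V E} {l : E → ℝ} {f : C(Subshift G.adjMat, ℝ)}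
    {h ρ : G.DirEdge → ℝ} (H : Subshift.IsPerron f (fun i => Real.exp (-l i.1)) h ρ)
    [Nonempty G.DirEdge] {p : G.DirEdge → ℝ} :
    G.IsStationaryVec l p ↔ p = fun i => h i * ρ i / ∑ j, h j * ρ j := by
  have hN : 0 < ∑ j, h j * ρ j :=
    Finset.sum_pos (fun j _ => mul_pos (H.left_pos j) (H.right_pos j)) Finset.univ_nonempty
  constructor
  · rintro ⟨v, hv, hvA, hp, hsum⟩
    rw [weightedMat_eq_letterMat] at hvA
    obtain ⟨c, rfl⟩ := H.exists_eq_smul_left hvA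
    have hc : c ≠ 0 := fun h0 => by
      have := hv (Classical.arbitrary _)
      simp [h0] at this
    have hw : (Subshift.letterMat G.adjMat fun i => Real.exp (-l i.1)).mulVec
        (fun j => p j / (c • h) j) = fun j => p j / (c • h) j := by
      funext i
      rw [eq_div_iff (hv i).ne', mul_comm, ← weightedMat_eq_letterMat, ← stochMat_mulVec, hp]
    obtain ⟨k, hk⟩ := H.exists_eq_smul_right hw
    have hpk : ∀ i, p i = k * c * (h i * ρ i) := fun i => by
      have := congrFun hk i
      rw [div_eq_iff (hv i).ne'] at this
      rw [this]
      simp only [Pi.smul_apply, smul_eq_mul]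
      ring
    simp_rw [hpk, ← Finset.mul_sum] at hsum
    funext i
    rw [hpk, eq_div_iff hN.ne']
    linear_combination (h i * ρ i) * hsum
  · rintro rfl
    refine ⟨h, H.left_pos, ?_, ?_, ?_⟩
    · rw [weightedMat_eq_letterMat, H.vecMul_left]
    · funext i
      have e : (fun j => h j * ρ j / (∑ k, h k * ρ k) / h j) = (∑ k, h k * ρ k)⁻¹ • ρ := by
        funext j
        have := (H.left_pos j).ne'
        simp only [Pi.smul_apply, smul_eq_mul]
        field_simp
      rw [stochMat_mulVec, weightedMat_eq_letterMat, e, Matrix.mulVec_smul, H.mulVec_right]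
      simp only [Pi.smul_apply, smul_eq_mul]
      ring
    · rw [← Finset.sum_div, div_self hN.ne']

end MultiGraph

/-! ### Transition matrix of the belt buckle -/

namespace BeltBuckle

theorem adjMat_eq_one_iff (d d' : graph.DirEdge) :
    graph.adjMat d d' = 1 ↔ d'.1 ≠ d.1 ∧ d'.2 = !d.2 := by
  obtain ⟨e, b⟩ := d
  obtain ⟨e', b'⟩ := d'
  cases b <;> cases b' <;>
    simp [MultiGraph.adjMat, MultiGraph.origin, MultiGraph.terminus, MultiGraph.opposite, graph]

/-- Each step reverses the direction, so edges of equal direction are joined in two steps and edges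
of opposite direction in three; three labels leave room to avoid repetitions. -/
theorem adjMat_connected (i j : graph.DirEdge) :
    (∃ k, graph.adjMat i k = 1 ∧ graph.adjMat k j = 1) ∨
      ∃ k k', graph.adjMat i k = 1 ∧ graph.adjMat k k' = 1 ∧ graph.adjMat k' j = 1 := by
  simp only [adjMat_eq_one_iff]
  revert i j
  decide

instance : Nonempty (Subshift graph.adjMat) :=
  ⟨⟨fun n => (fun d : graph.DirEdge => (d.1 + 1, !d.2))^[n] (0, false), fun n => by
    refine (adjMat_eq_one_iff _ _).2 ?_
    simp only [Function.iterate_succ_apply']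
    generalize (fun d : graph.DirEdge => (d.1 + 1, !d.2))^[n] (0, false) = d
    exact ⟨by simp, trivial⟩⟩⟩

theorem letterMat_eq (s : Fin 3 → ℝ) (d d' : graph.DirEdge) :
    Subshift.letterMat graph.adjMat (fun i => s i.1) d d' =
      if d'.1 ≠ d.1 ∧ d'.2 = !d.2 then s d.1 else 0 := by
  split_ifs with h
  · rw [Subshift.letterMat_of_eq ((adjMat_eq_one_iff d d').2 h)]
  · rw [Subshift.letterMat_of_ne fun h' => h ((adjMat_eq_one_iff d d').1 h')]

/-- The predecessors of `j` are the oppositely directed edges with the other two labels, so the sum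
runs over all labels but that of `j`. -/
theorem vecMul_letterMat (s w : Fin 3 → ℝ) (j : graph.DirEdge) :
    Matrix.vecMul (fun i : graph.DirEdge => w i.1)
      (Subshift.letterMat graph.adjMat fun i => s i.1) j = ∑ e, s e * w e - s j.1 * w j.1 := by
  simp only [Matrix.vecMul, dotProduct, letterMat_eq, Fintype.sum_prod_type, Fintype.sum_bool,
    Fin.sum_univ_three]
  obtain ⟨e, b⟩ := j
  fin_cases e <;> cases b <;> simp <;> ring

theorem mulVec_letterMat (s w : Fin 3 → ℝ) (i : graph.DirEdge) :
    (Subshift.letterMat graph.adjMat fun i => s i.1).mulVec (fun j : graph.DirEdge => w j.1) i =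
      s i.1 * (∑ e, w e - w i.1) := by
  simp only [Matrix.mulVec, dotProduct, letterMat_eq, Fintype.sum_prod_type, Fintype.sum_bool,
    Fin.sum_univ_three]
  obtain ⟨e, b⟩ := i
  fin_cases e <;> cases b <;> simp <;> ring

theorem sum_dirEdge (w : Fin 3 → ℝ) : ∑ i : graph.DirEdge, w i.1 = 2 * ∑ e, w e := by
  simp only [Fintype.sum_prod_type, Fintype.sum_bool, Finset.mul_sum, two_mul]

/-- The left and right eigenvectors, for edge weightings of pressure zero. -/
theorem isPerron {l : Fin 3 → ℝ} (hl : ∑ e, 1 / (1 + Real.exp (l e)) = 1) :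
    Subshift.IsPerron (-graph.edgeFun l) (fun i => Real.exp (-l i.1))
      (fun i => 1 / (1 + Real.exp (-l i.1)))
      (fun i => Real.exp (-l i.1) / (1 + Real.exp (-l i.1))) := by
  have hsum : ∑ e, Real.exp (-l e) / (1 + Real.exp (-l e)) = 1 := by
    refine (Finset.sum_congr rfl fun e _ => ?_).trans hl
    rw [Real.exp_neg]
    have := Real.exp_pos (l e)
    field_simp
    ring
  have hpos : ∀ e, 1 + Real.exp (-l e) ≠ 0 := fun e => by positivity
  refine ⟨fun x => rfl, fun i => Real.exp_pos _, ?_, ?_, fun i => by positivity, ?_,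
    fun i => by positivity, ?_⟩
  · rintro s ⟨i, hi⟩ hs
    refine Set.eq_univ_of_forall fun j => ?_
    obtain ⟨k, h1, h2⟩ | ⟨k, k', h1, h2, h3⟩ := adjMat_connected j i
    · exact hs _ _ h1 (hs _ _ h2 hi)
    · exact hs _ _ h1 (hs _ _ h2 (hs _ _ h3 hi))
  · rintro s ⟨i, hi⟩ hs
    refine Set.eq_univ_of_forall fun j => ?_
    obtain ⟨k, h1, h2⟩ | ⟨k, k', h1, h2, h3⟩ := adjMat_connected i j
    · exact hs _ _ h2 (hs _ _ h1 hi)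
    · exact hs _ _ h3 (hs _ _ h2 (hs _ _ h1 hi))
  · funext j
    -- With `s = e^{-l}`, the claim is `1 - s/(1+s) = 1/(1+s)`, where the `1` is the pressure-zero
    -- condition `hsum`.
    rw [vecMul_letterMat (fun e => Real.exp (-l e)) (fun e => 1 / (1 + Real.exp (-l e)))]
    simp_rw [mul_one_div]
    rw [hsum]
    have := hpos j.1
    field_simp
    ring
  · funext i
    rw [mulVec_letterMat (fun e => Real.exp (-l e))
      (fun e => Real.exp (-l e) / (1 + Real.exp (-l e))), hsum]
    have := hpos i.1
    field_simp
    ring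

/-! ### Entropy -/

theorem hasEntropy {l : Fin 3 → ℝ} (hl : ∀ e, 0 < l e) {δ : ℝ} (hδ : 0 ≤ δ)
    (h : ∑ e, 1 / (1 + Real.exp (δ * l e)) = 1) : graph.HasEntropy l δ := by
  -- The rescaled weighting `δ l` has pressure zero; its right eigenvector is the comparison
  -- function for counting.
  have H := isPerron (l := fun e => δ * l e) h
  refine MultiGraph.hasEntropy_of_mulVec_eq hl hδ H.right_pos H.mulVec_right (fun i => ?_)
    (fun i j => ?_) (i₀ := (0, false)) (k₀ := (1, true)) (by decide)
  · have h2 := mulVec_letterMat (fun _ => 1) (fun _ => 1) i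
    simp only [Matrix.mulVec, dotProduct, mul_one, one_mul, Fin.sum_univ_three] at h2
    have h3 : ∑ k, Subshift.letterMat graph.adjMat 1 i k = 1 + 1 + 1 - 1 := h2
    rw [h3]
    norm_num
  · obtain ⟨k, h1, h2⟩ | ⟨k, k', h1, h2, h3⟩ := adjMat_connected i j
    · exact ⟨[i, k, j], by simp [h1, h2], rfl, rfl⟩
    · exact ⟨[i, k, k', j], by simp [h1, h2, h3], rfl, rfl⟩

theorem exists_sum_eq_one {l : Fin 3 → ℝ} (hl : ∀ e, 0 < l e) :
    ∃ δ : ℝ, 0 ≤ δ ∧ ∑ e, 1 / (1 + Real.exp (δ * l e)) = 1 := by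
  obtain ⟨a, ha, hle⟩ := exists_pos_le hl
  have hcont : Continuous fun s : ℝ => ∑ e, 1 / (1 + Real.exp (s * l e)) :=
    continuous_finsetSum _ fun e _ => Continuous.div (by fun_prop) (by fun_prop)
      fun s => by positivity
  have h0 : 0 ≤ 1 / a := by positivity
  have h1 : (1 : ℝ) ≤ ∑ e : Fin 3, 1 / (1 + Real.exp (0 * l e)) := by
    norm_num [Fin.sum_univ_three]
  -- At `s = 1/a` all exponents are at least `1` and `e^t ≥ t + 1 ≥ 2`, so each term is at most
  -- `1/3`; at `s = 0` the sum is `3/2`.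
  have h2 : ∑ e, 1 / (1 + Real.exp (1 / a * l e)) ≤ (1 : ℝ) := by
    calc ∑ e, 1 / (1 + Real.exp (1 / a * l e)) ≤ ∑ _e : Fin 3, (1 / 3 : ℝ) := by
          refine Finset.sum_le_sum fun e _ => ?_
          have h3 : 1 ≤ 1 / a * l e := by
            rw [one_div, inv_mul_eq_div, one_le_div ha]
            exact hle e
          have h4 := Real.add_one_le_exp (1 / a * l e)
          gcongr
          linarith
      _ = 1 := by norm_num
  obtain ⟨δ, hδ, hδ'⟩ := intermediate_value_Icc' h0 hcont.continuousOn ⟨h2, h1⟩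
  exact ⟨δ, hδ.1, hδ'⟩

/-- Some root `δ` exists and the entropy equals it; uniqueness of limits forces `δ = 1`, so
monotonicity in `δ` is not needed. -/
theorem mem_moduliOne_iff {l : Fin 3 → ℝ} :
    l ∈ graph.moduliOne ↔ (∀ e, 0 < l e) ∧ ∑ e, 1 / (1 + Real.exp (l e)) = 1 := by
  constructor
  · rintro ⟨hl, hent⟩
    refine ⟨hl, ?_⟩
    obtain ⟨δ, hδ, hsum⟩ := exists_sum_eq_one hl
    have : δ = 1 := tendsto_nhds_unique (hasEntropy hl hδ hsum) hent
    simpa [this] using hsum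
  · rintro ⟨hl, hsum⟩
    exact ⟨hl, hasEntropy hl zero_le_one (by simpa using hsum)⟩

/-! ### The parametrisation -/

theorem one_lt_exp_mul_exp {x y : ℝ} (hx : 0 < x) (hy : 0 < y) :
    1 < Real.exp x * Real.exp y := by
  rw [← Real.exp_add]
  exact Real.one_lt_exp_iff.2 (by linarith)

theorem exp_S {x y : ℝ} (hxy : 1 < Real.exp x * Real.exp y) :
    Real.exp (S x y) = (Real.exp x + Real.exp y + 2) / (Real.exp x * Real.exp y - 1) := by
  have h1 : 0 < Real.exp x * Real.exp y - 1 := by linarith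
  have h2 : 0 < Real.exp x + Real.exp y + 2 := by positivity
  rw [S, Real.exp_neg, Real.exp_add, Real.exp_log (div_pos h1 h2), inv_div]

theorem sum_l {x y : ℝ} (hxy : 1 < Real.exp x * Real.exp y) :
    ∑ e, 1 / (1 + Real.exp (l x y e)) = 1 := by
  have e0 : l x y 0 = x := rfl
  have e1 : l x y 1 = y := rfl
  have e2 : l x y 2 = S x y := rfl
  rw [Fin.sum_univ_three, e0, e1, e2, exp_S hxy]
  have hX := Real.exp_pos x
  have hY := Real.exp_pos y
  set X := Real.exp x
  set Y := Real.exp y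
  have h1 : X * Y - 1 ≠ 0 := by linarith
  have h2 : 1 + (X + Y + 2) / (X * Y - 1) = (X + 1) * (Y + 1) / (X * Y - 1) := by
    field_simp
    ring
  rw [h2]
  field_simp
  ring

theorem bijOn_l :
    Set.BijOn (fun q : ℝ × ℝ => l q.1 q.2) domain graph.moduliOne := by
  refine ⟨?_, ?_, ?_⟩
  · rintro ⟨x, y⟩ ⟨hx, hy, hlt⟩
    simp only at hx hy hlt
    have hxy := one_lt_exp_mul_exp hx hy
    refine mem_moduliOne_iff.2 ⟨fun e => ?_, sum_l hxy⟩
    fin_cases e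
    · exact hx
    · exact hy
    · show 0 < S x y
      rw [← Real.one_lt_exp_iff, exp_S hxy, one_lt_div (by linarith)]
      rw [Real.exp_add] at hlt
      linarith
  · rintro ⟨x, y⟩ - ⟨x', y'⟩ - h
    exact Prod.ext (congrFun h 0) (congrFun h 1)
  · intro l' hl'
    obtain ⟨hpos, hsum⟩ := mem_moduliOne_iff.1 hl'
    have hx := hpos 0
    have hy := hpos 1
    have hxy := one_lt_exp_mul_exp hx hy
    -- The constraint determines its third summand from the other two, and `t ↦ 1/(1+e^t)` is
    -- injective.
    have hZ : Real.exp (l' 2) = Real.exp (S (l' 0) (l' 1)) := by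
      have h1 := sum_l hxy
      have e0 : l (l' 0) (l' 1) 0 = l' 0 := rfl
      have e1 : l (l' 0) (l' 1) 1 = l' 1 := rfl
      have e2 : l (l' 0) (l' 1) 2 = S (l' 0) (l' 1) := rfl
      rw [Fin.sum_univ_three] at h1 hsum
      rw [e0, e1, e2] at h1
      have h2 : 1 / (1 + Real.exp (l' 2)) = 1 / (1 + Real.exp (S (l' 0) (l' 1))) := by linarith
      rw [one_div, one_div] at h2
      have h3 := inv_injective h2
      linarith
    refine ⟨(l' 0, l' 1), ⟨hx, hy, ?_⟩, ?_⟩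
    · have h1 := Real.one_lt_exp_iff.2 (hpos 2)
      rw [hZ, exp_S hxy, one_lt_div (by linarith)] at h1
      simp only
      rw [Real.exp_add]
      linarith
    · funext e
      fin_cases e
      · rfl
      · rfl
      · exact (Real.exp_injective hZ).symm

end BeltBuckle

namespace BeltBuckle

/-! ### Letter averages and the variance -/

section Gibbs

variable {l : Fin 3 → ℝ} {m : Measure (Subshift graph.adjMat)}

theorem left_mul_right (a : ℝ) :
    1 / (1 + Real.exp (-a)) * (Real.exp (-a) / (1 + Real.exp (-a))) =
      Real.exp a / (1 + Real.exp a) ^ 2 := by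
  rw [Real.exp_neg]
  have := Real.exp_pos a
  field_simp
  ring

theorem integral_edge (hl : ∑ e, 1 / (1 + Real.exp (l e)) = 1)
    (hm : Subshift.IsEquilibriumState (-graph.edgeFun l) m) (φ : Fin 3 → ℝ) :
    ∫ x, φ (Subshift.coord 0 x).1 ∂m =
      (∑ e, φ e * (Real.exp (l e) / (1 + Real.exp (l e)) ^ 2)) /
        ∑ e, Real.exp (l e) / (1 + Real.exp (l e)) ^ 2 := by
  rw [hm.integral_letter (isPerron hl) fun d => φ d.1]
  simp only [left_mul_right]
  rw [sum_dirEdge fun e => φ e * (Real.exp (l e) / (1 + Real.exp (l e)) ^ 2),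
    sum_dirEdge fun e => Real.exp (l e) / (1 + Real.exp (l e)) ^ 2,
    mul_div_mul_left _ _ two_ne_zero]

theorem isStationaryVec_iff (hl : ∑ e, 1 / (1 + Real.exp (l e)) = 1)
    {p : graph.DirEdge → ℝ} : graph.IsStationaryVec l p ↔
      p = fun d => Real.exp (l d.1) / (1 + Real.exp (l d.1)) ^ 2 /
        (2 * ∑ e, Real.exp (l e) / (1 + Real.exp (l e)) ^ 2) := by
  rw [MultiGraph.isStationaryVec_iff (isPerron hl)]
  simp only [left_mul_right]
  rw [sum_dirEdge fun e => Real.exp (l e) / (1 + Real.exp (l e)) ^ 2]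

/-- The mean-zero condition `hφ` kills the common sum in `vecMul_letterMat`, so the normalised
transfer operator multiplies `u = φ/(1+s)` by `-s`, and `u - g = u + su = φ`. Weighting `u² - g² =
φ²(1-s)/(1+s)` by the letter law gives the summands. -/
theorem hasVariance_edgeFun (hl : ∑ e, 1 / (1 + Real.exp (l e)) = 1)
    (hm : Subshift.IsEquilibriumState (-graph.edgeFun l) m) {φ : Fin 3 → ℝ}
    (hφ : ∑ e, φ e * (Real.exp (l e) / (1 + Real.exp (l e)) ^ 2) = 0) :
    Subshift.HasVariance (graph.edgeFun φ) m
      ((∑ e, φ e ^ 2 * (Real.exp (l e) * (Real.exp (l e) - 1) / (1 + Real.exp (l e)) ^ 3)) /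
        ∑ e, Real.exp (l e) / (1 + Real.exp (l e)) ^ 2) := by
  have hpos : ∀ e, 1 + Real.exp (-l e) ≠ 0 := fun e => by positivity
  have key := hm.hasVariance (isPerron hl)
    (u := fun d => φ d.1 / (1 + Real.exp (-l d.1)))
    (g := fun d => -(Real.exp (-l d.1) * φ d.1) / (1 + Real.exp (-l d.1))) (by
      funext j
      rw [vecMul_letterMat (fun e => Real.exp (-l e))
        (fun e => φ e / (1 + Real.exp (-l e)) * (1 / (1 + Real.exp (-l e))))]
      have h0 : ∑ e, Real.exp (-l e) *
          (φ e / (1 + Real.exp (-l e)) * (1 / (1 + Real.exp (-l e)))) = 0 := by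
        refine (Finset.sum_congr rfl fun e _ => ?_).trans hφ
        rw [← left_mul_right]
        ring
      rw [h0]
      ring)
  have h1 : Subshift.letterFun graph.adjMat ((fun d => φ d.1 / (1 + Real.exp (-l d.1))) -
      fun d => -(Real.exp (-l d.1) * φ d.1) / (1 + Real.exp (-l d.1))) = graph.edgeFun φ := by
    ext x
    show φ (Subshift.coord 0 x).1 / (1 + Real.exp (-l (Subshift.coord 0 x).1)) -
      -(Real.exp (-l (Subshift.coord 0 x).1) * φ (Subshift.coord 0 x).1) /
        (1 + Real.exp (-l (Subshift.coord 0 x).1)) = φ (Subshift.coord 0 x).1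
    have := hpos (Subshift.coord 0 x).1
    field_simp
    ring
  rw [h1, integral_edge hl hm fun e => (φ e / (1 + Real.exp (-l e))) ^ 2 -
    (-(Real.exp (-l e) * φ e) / (1 + Real.exp (-l e))) ^ 2] at key
  convert key using 3 with e
  rw [Real.exp_neg]
  have := Real.exp_pos (l e)
  field_simp
  ring

end Gibbs

/-! ### Derivatives of the parametrisation -/

/-- `∂S/∂x`. -/
noncomputable def Sx (x y : ℝ) : ℝ :=
  Real.exp x / (Real.exp x + Real.exp y + 2) - Real.exp (x + y) / (Real.exp (x + y) - 1)

theorem S_comm (x y : ℝ) : S x y = S y x := by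
  rw [S, S, add_comm x y, add_comm (Real.exp x)]

theorem hasDerivAt_S {x y : ℝ} (hxy : 0 < x + y) : HasDerivAt (fun t => S t y) (Sx x y) x := by
  have h1 : Real.exp (x + y) - 1 ≠ 0 := (sub_pos.2 (Real.one_lt_exp_iff.2 hxy)).ne'
  have h2 : Real.exp x + Real.exp y + 2 ≠ 0 := by positivity
  have d1 : HasDerivAt (fun t => Real.exp (t + y) - 1) (Real.exp (x + y)) x := by
    simpa using (((hasDerivAt_id x).add_const y).exp).sub_const 1
  have d2 : HasDerivAt (fun t => Real.exp t + Real.exp y + 2) (Real.exp x) x :=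
    ((Real.hasDerivAt_exp x).add_const _).add_const _
  refine ((d1.fun_div d2 h2).log (div_ne_zero h1 h2)).fun_neg.congr_deriv ?_
  rw [Sx]
  field_simp
  ring

theorem hasDerivAt_S' {x y : ℝ} (hxy : 0 < x + y) : HasDerivAt (fun t => S x t) (Sx y x) y := by
  simp_rw [S_comm x]
  exact hasDerivAt_S (by linarith)

theorem dlx_eq {x y : ℝ} (hxy : 0 < x + y) : dlx x y = ![1, 0, Sx x y] := by
  refine HasDerivAt.deriv (hasDerivAt_pi.2 fun e => ?_)
  fin_cases e
  · exact hasDerivAt_id x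
  · exact hasDerivAt_const x y
  · exact hasDerivAt_S hxy

theorem dly_eq {x y : ℝ} (hxy : 0 < x + y) : dly x y = ![0, 1, Sx y x] := by
  refine HasDerivAt.deriv (hasDerivAt_pi.2 fun e => ?_)
  fin_cases e
  · exact hasDerivAt_const y x
  · exact hasDerivAt_id y
  · exact hasDerivAt_S' hxy

theorem eventually_add_pos {x y : ℝ} (hxy : 0 < x + y) : ∀ᶠ t in 𝓝 x, 0 < t + y :=
  (continuous_id.add continuous_const).continuousAt.eventually (lt_mem_nhds hxy)

theorem Sxx_eq {x y : ℝ} (hxy : 0 < x + y) :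
    Sxx x y = Real.exp x * (Real.exp y + 2) / (Real.exp x + Real.exp y + 2) ^ 2 +
      Real.exp (x + y) / (Real.exp (x + y) - 1) ^ 2 := by
  have h1 : Real.exp (x + y) - 1 ≠ 0 := (sub_pos.2 (Real.one_lt_exp_iff.2 hxy)).ne'
  have h2 : Real.exp x + Real.exp y + 2 ≠ 0 := by positivity
  have d0 : HasDerivAt (fun t => Real.exp (t + y)) (Real.exp (x + y)) x := by
    simpa using ((hasDerivAt_id x).add_const y).exp
  have d2 : HasDerivAt (fun t => Real.exp t + Real.exp y + 2) (Real.exp x) x :=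
    ((Real.hasDerivAt_exp x).add_const _).add_const _
  have d : HasDerivAt (fun t => Sx t y) _ x :=
    ((Real.hasDerivAt_exp x).fun_div d2 h2).fun_sub (d0.fun_div (d0.sub_const 1) h1)
  -- The formula for the first derivative is available only where `t + y > 0`, hence near `x`, which
  -- suffices for the second derivative.
  have e : (fun t => deriv (fun s => S s y) t) =ᶠ[𝓝 x] fun t => Sx t y :=
    (eventually_add_pos hxy).mono fun t ht => (hasDerivAt_S ht).deriv
  rw [Sxx, e.deriv_eq, d.deriv]
  field_simp
  ring

theorem Syy_eq_Sxx (x y : ℝ) : Syy x y = Sxx y x := by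
  simp only [Syy, Sxx, S_comm x]

theorem Sxy_eq {x y : ℝ} (hxy : 0 < x + y) :
    Sxy x y = Real.exp (x + y) / (Real.exp (x + y) - 1) ^ 2 -
      Real.exp (x + y) / (Real.exp x + Real.exp y + 2) ^ 2 := by
  have h1 : Real.exp (x + y) - 1 ≠ 0 := (sub_pos.2 (Real.one_lt_exp_iff.2 hxy)).ne'
  have h2 : Real.exp x + Real.exp y + 2 ≠ 0 := by positivity
  have d0 : HasDerivAt (fun t => Real.exp (t + y)) (Real.exp (x + y)) x := by
    simpa using ((hasDerivAt_id x).add_const y).exp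
  have d2 : HasDerivAt (fun t => Real.exp t + Real.exp y + 2) (Real.exp x) x :=
    ((Real.hasDerivAt_exp x).add_const _).add_const _
  have d := ((hasDerivAt_const x (Real.exp y)).fun_div d2 h2).fun_sub
    (d0.fun_div (d0.sub_const 1) h1)
  have e : (fun s => deriv (fun t => S s t) y) =ᶠ[𝓝 x] fun s =>
      Real.exp y / (Real.exp s + Real.exp y + 2) -
        Real.exp (s + y) / (Real.exp (s + y) - 1) :=
    (eventually_add_pos hxy).mono fun s hs => by
      simp only
      rw [(hasDerivAt_S' hs).deriv, Sx, add_comm (Real.exp y), add_comm y]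
  rw [Sxy, e.deriv_eq, d.deriv]
  rw [Real.exp_add] at h1 ⊢
  field_simp
  ring

/-! ### The rational functions of `X = e^x`, `Y = e^y` -/

section Algebra

variable {x y : ℝ}

theorem Sx_eq (hxy : 1 < Real.exp x * Real.exp y) :
    Sx x y = -(Real.exp x * (Real.exp y + 1) ^ 2) /
      ((Real.exp x + Real.exp y + 2) * (Real.exp x * Real.exp y - 1)) := by
  have h1 : Real.exp x * Real.exp y - 1 ≠ 0 := by linarith
  have h2 : Real.exp x + Real.exp y + 2 ≠ 0 := by positivity
  rw [Sx, Real.exp_add]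
  field_simp
  ring

theorem one_add_exp_S (hxy : 1 < Real.exp x * Real.exp y) :
    1 + Real.exp (S x y) =
      (Real.exp x + 1) * (Real.exp y + 1) / (Real.exp x * Real.exp y - 1) := by
  have h1 : Real.exp x * Real.exp y - 1 ≠ 0 := by linarith
  rw [exp_S hxy]
  field_simp
  ring

theorem weight_S (hxy : 1 < Real.exp x * Real.exp y) :
    Real.exp (S x y) / (1 + Real.exp (S x y)) ^ 2 =
      (Real.exp x + Real.exp y + 2) * (Real.exp x * Real.exp y - 1) /
        ((Real.exp x + 1) ^ 2 * (Real.exp y + 1) ^ 2) := by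
  have h1 : Real.exp x * Real.exp y - 1 ≠ 0 := by linarith
  rw [one_add_exp_S hxy, exp_S hxy]
  field_simp

theorem weight'_S (hxy : 1 < Real.exp x * Real.exp y) :
    Real.exp (S x y) * (Real.exp (S x y) - 1) / (1 + Real.exp (S x y)) ^ 3 =
      (Real.exp x + Real.exp y + 2) * (Real.exp x * Real.exp y - 1) *
        (Real.exp x + Real.exp y + 3 - Real.exp x * Real.exp y) /
        ((Real.exp x + 1) ^ 3 * (Real.exp y + 1) ^ 3) := by
  have h1 : Real.exp x * Real.exp y - 1 ≠ 0 := by linarith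
  rw [one_add_exp_S hxy, exp_S hxy]
  field_simp
  ring

/-- The polynomial `3XY + X²Y + XY² - 1` in `X = e^x` and `Y = e^y`. -/
noncomputable def massPoly (x y : ℝ) : ℝ :=
  3 * (Real.exp x * Real.exp y) + Real.exp x ^ 2 * Real.exp y + Real.exp x * Real.exp y ^ 2 - 1

theorem massPoly_pos (hxy : 1 < Real.exp x * Real.exp y) : 0 < massPoly x y := by
  have h1 : 0 < Real.exp x ^ 2 * Real.exp y := by positivity
  have h2 : 0 < Real.exp x * Real.exp y ^ 2 := by positivity
  rw [massPoly]
  linarith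

theorem massPoly_comm (x y : ℝ) : massPoly x y = massPoly y x := by
  rw [massPoly, massPoly]
  ring

theorem sum_weight (hxy : 1 < Real.exp x * Real.exp y) :
    ∑ e, Real.exp (l x y e) / (1 + Real.exp (l x y e)) ^ 2 =
      2 * massPoly x y / ((Real.exp x + 1) ^ 2 * (Real.exp y + 1) ^ 2) := by
  have e0 : l x y 0 = x := rfl
  have e1 : l x y 1 = y := rfl
  have e2 : l x y 2 = S x y := rfl
  rw [Fin.sum_univ_three, e0, e1, e2, weight_S hxy, massPoly]
  field_simp
  ring

theorem denom_eq (x y : ℝ) :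
    denom x y = 2 * (Real.exp x + Real.exp y + 2) * (Real.exp x * Real.exp y - 1) *
      massPoly x y := by
  have h1 : Real.exp (2 * x + y) = Real.exp x ^ 2 * Real.exp y := by
    rw [two_mul, Real.exp_add, Real.exp_add, sq]
  have h2 : Real.exp (x + 2 * y) = Real.exp x * Real.exp y ^ 2 := by
    rw [two_mul, Real.exp_add, Real.exp_add, sq]
  rw [denom, h1, h2, Real.exp_add, massPoly]

theorem denom_comm (x y : ℝ) : denom x y = denom y x := by
  rw [denom_eq, denom_eq, massPoly_comm]
  ring

theorem GP_eq_EP (x y : ℝ) : GP x y = EP y x := by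
  rw [GP, EP, denom_comm, add_comm x (2 * y)]
  ring

theorem EP_eq (x y : ℝ) :
    EP x y = Real.exp x * (Real.exp y + 1) ^ 2 *
      (Real.exp x ^ 2 * Real.exp y + Real.exp y + 2) /
        (2 * (Real.exp x + Real.exp y + 2) * (Real.exp x * Real.exp y - 1) * massPoly x y) := by
  rw [EP, denom_eq, two_mul, Real.exp_add, Real.exp_add, sq (Real.exp x)]

theorem FP_eq (x y : ℝ) :
    FP x y = (Real.exp x + 1) * (Real.exp y + 1) * (Real.exp x * Real.exp y) *
      (-(Real.exp x * Real.exp y) + Real.exp x + Real.exp y + 3) /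
        (2 * (Real.exp x + Real.exp y + 2) * (Real.exp x * Real.exp y - 1) * massPoly x y) := by
  rw [FP, denom_eq, Real.exp_add]

theorem two_mul_Sxx (hxy : 1 < Real.exp x * Real.exp y) :
    2 * Sxx x y * (Real.exp (S x y) / (1 + Real.exp (S x y)) ^ 2 /
      (2 * ∑ e, Real.exp (l x y e) / (1 + Real.exp (l x y e)) ^ 2)) = EP x y := by
  have h1 : Real.exp x * Real.exp y - 1 ≠ 0 := by linarith
  have h2 := (massPoly_pos hxy).ne'
  have h3 : 0 < x + y := by rwa [← Real.exp_add, Real.one_lt_exp_iff] at hxy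
  rw [sum_weight hxy, weight_S hxy, Sxx_eq h3, EP_eq, Real.exp_add]
  field_simp
  ring

theorem two_mul_Sxy (hxy : 1 < Real.exp x * Real.exp y) :
    2 * Sxy x y * (Real.exp (S x y) / (1 + Real.exp (S x y)) ^ 2 /
      (2 * ∑ e, Real.exp (l x y e) / (1 + Real.exp (l x y e)) ^ 2)) = FP x y := by
  have h1 : Real.exp x * Real.exp y - 1 ≠ 0 := by linarith
  have h2 := (massPoly_pos hxy).ne'
  have h3 : 0 < x + y := by rwa [← Real.exp_add, Real.one_lt_exp_iff] at hxy
  rw [sum_weight hxy, weight_S hxy, Sxy_eq h3, FP_eq, Real.exp_add]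
  field_simp
  ring

theorem sum_weight_comm (hxy : 1 < Real.exp x * Real.exp y) :
    ∑ e, Real.exp (l x y e) / (1 + Real.exp (l x y e)) ^ 2 =
      ∑ e, Real.exp (l y x e) / (1 + Real.exp (l y x e)) ^ 2 := by
  rw [sum_weight hxy, sum_weight (by rwa [mul_comm]), massPoly_comm, mul_comm (_ ^ 2)]

theorem two_mul_Syy (hxy : 1 < Real.exp x * Real.exp y) :
    2 * Syy x y * (Real.exp (S x y) / (1 + Real.exp (S x y)) ^ 2 /
      (2 * ∑ e, Real.exp (l x y e) / (1 + Real.exp (l x y e)) ^ 2)) = GP x y := by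
  rw [GP_eq_EP, Syy_eq_Sxx, ← two_mul_Sxx (by rwa [mul_comm]), sum_weight_comm hxy, S_comm x]

/-- The `x`-derivative of `∑ 1/(1+e^{l_e}) = 1`, up to sign; it says that `∂l/∂x` has mean zero. -/
theorem weight_add_Sx (hxy : 1 < Real.exp x * Real.exp y) :
    Real.exp x / (1 + Real.exp x) ^ 2 +
      Sx x y * (Real.exp (S x y) / (1 + Real.exp (S x y)) ^ 2) = 0 := by
  have h1 : Real.exp x * Real.exp y - 1 ≠ 0 := by linarith
  rw [weight_S hxy, Sx_eq hxy]
  field_simp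
  ring

/-- `e^a (e^a - 1)/(1+e^a)^3` is the second derivative of `1/(1+e^a)`. Differentiating the
constraint twice in `x` therefore turns the numerator into `∂²S/∂x²` times the weight of the third
edge, in agreement with `two_mul_Sxx`. -/
theorem variance_xx (hxy : 1 < Real.exp x * Real.exp y) :
    (Real.exp x * (Real.exp x - 1) / (1 + Real.exp x) ^ 3 +
      Sx x y ^ 2 * (Real.exp (S x y) * (Real.exp (S x y) - 1) / (1 + Real.exp (S x y)) ^ 3)) /
      (∑ e, Real.exp (l x y e) / (1 + Real.exp (l x y e)) ^ 2) = EP x y := by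
  have h1 : Real.exp x * Real.exp y - 1 ≠ 0 := by linarith
  have h2 := (massPoly_pos hxy).ne'
  rw [sum_weight hxy, weight'_S hxy, Sx_eq hxy, EP_eq]
  field_simp
  ring

theorem variance_xy (hxy : 1 < Real.exp x * Real.exp y) :
    Sx x y * Sx y x *
      (Real.exp (S x y) * (Real.exp (S x y) - 1) / (1 + Real.exp (S x y)) ^ 3) /
      (∑ e, Real.exp (l x y e) / (1 + Real.exp (l x y e)) ^ 2) = FP x y := by
  have h1 : Real.exp x * Real.exp y - 1 ≠ 0 := by linarith
  have h1' : Real.exp y * Real.exp x - 1 ≠ 0 := by rwa [mul_comm]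
  have h2 := (massPoly_pos hxy).ne'
  rw [sum_weight hxy, weight'_S hxy, Sx_eq hxy, Sx_eq (by rwa [mul_comm]), FP_eq,
    mul_comm (Real.exp y) (Real.exp x)]
  field_simp
  ring

theorem variance_yy (hxy : 1 < Real.exp x * Real.exp y) :
    (Real.exp y * (Real.exp y - 1) / (1 + Real.exp y) ^ 3 +
      Sx y x ^ 2 * (Real.exp (S x y) * (Real.exp (S x y) - 1) / (1 + Real.exp (S x y)) ^ 3)) /
      (∑ e, Real.exp (l x y e) / (1 + Real.exp (l x y e)) ^ 2) = GP x y := by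
  rw [GP_eq_EP, ← variance_xx (by rwa [mul_comm]), sum_weight_comm hxy, S_comm x]

theorem sum_tangent_eq_zero (hxy : 1 < Real.exp x * Real.exp y) (a b : ℝ) :
    ∑ e, (![a, b, a * Sx x y + b * Sx y x] : Fin 3 → ℝ) e *
      (Real.exp (l x y e) / (1 + Real.exp (l x y e)) ^ 2) = 0 := by
  have hx := weight_add_Sx hxy
  have hy := weight_add_Sx (x := y) (y := x) (by rwa [mul_comm])
  rw [S_comm y x] at hy
  rw [Fin.sum_univ_three]
  show a * (Real.exp x / (1 + Real.exp x) ^ 2) + b * (Real.exp y / (1 + Real.exp y) ^ 2) +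
    (a * Sx x y + b * Sx y x) * (Real.exp (S x y) / (1 + Real.exp (S x y)) ^ 2) = 0
  linear_combination a * hx + b * hy

theorem hasVariance_tangent (hxy : 1 < Real.exp x * Real.exp y)
    {m : Measure (Subshift graph.adjMat)}
    (hm : Subshift.IsEquilibriumState (-graph.edgeFun (l x y)) m) (a b : ℝ) :
    Subshift.HasVariance (graph.edgeFun (a • dlx x y + b • dly x y)) m
      (a ^ 2 * EP x y + 2 * a * b * FP x y + b ^ 2 * GP x y) := by
  have h3 : 0 < x + y := by rwa [← Real.exp_add, Real.one_lt_exp_iff] at hxy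
  have e : a • dlx x y + b • dly x y = ![a, b, a * Sx x y + b * Sx y x] := by
    rw [dlx_eq h3, dly_eq h3]
    funext i
    fin_cases i <;> simp
  have key := hasVariance_edgeFun (sum_l hxy) hm (sum_tangent_eq_zero hxy a b)
  rw [← e] at key
  convert key using 1
  -- The variance is diagonal in the edges. Only the third coordinate mixes `a` and `b`, so `F_P`
  -- comes from that edge alone.
  rw [← variance_xx hxy, ← variance_xy hxy, ← variance_yy hxy, e, Fin.sum_univ_three
    (fun i => (![a, b, a * Sx x y + b * Sx y x] : Fin 3 → ℝ) i ^ 2 *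
      (Real.exp (l x y i) * (Real.exp (l x y i) - 1) / (1 + Real.exp (l x y i)) ^ 3))]
  generalize ∑ i, Real.exp (l x y i) / (1 + Real.exp (l x y i)) ^ 2 = N
  show _ = (a ^ 2 * (Real.exp x * (Real.exp x - 1) / (1 + Real.exp x) ^ 3) +
    b ^ 2 * (Real.exp y * (Real.exp y - 1) / (1 + Real.exp y) ^ 3) +
    (a * Sx x y + b * Sx y x) ^ 2 *
      (Real.exp (S x y) * (Real.exp (S x y) - 1) / (1 + Real.exp (S x y)) ^ 3)) / N
  ring

theorem tangent_mem_tangentSpace (hxy : 1 < Real.exp x * Real.exp y)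
    {m : Measure (Subshift graph.adjMat)}
    (hm : Subshift.IsEquilibriumState (-graph.edgeFun (l x y)) m) (a b : ℝ) :
    ⇑(graph.edgeFun (![a, b, a * Sx x y + b * Sx y x] : Fin 3 → ℝ)) ∈ graph.tangentSpace m := by
  refine ⟨⟨fun d => (![a, b, a * Sx x y + b * Sx y x] : Fin 3 → ℝ) d.1, fun _ => rfl⟩, ?_⟩
  have h := integral_edge (sum_l hxy) hm ![a, b, a * Sx x y + b * Sx y x]
  rw [sum_tangent_eq_zero hxy, zero_div] at h
  exact h

end Algebra

end BeltBuckle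

/-- The map `(x, y) ↦ l(x, y)` parametrizes the moduli space of the belt buckle, and in the
coordinates `(x, y)` the pressure metric has the coefficients `E_P`, `F_P`, `G_P`. -/
theorem proposition4p3 :
    Set.BijOn (fun q : ℝ × ℝ => BeltBuckle.l q.1 q.2) BeltBuckle.domain
      BeltBuckle.graph.moduliOne ∧
    ∀ x y : ℝ, (x, y) ∈ BeltBuckle.domain →
      (∃! m : Measure (Subshift BeltBuckle.graph.adjMat),
        Subshift.IsEquilibriumState (-BeltBuckle.graph.edgeFun (BeltBuckle.l x y)) m) ∧
      (∃! p : BeltBuckle.graph.DirEdge → ℝ,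
        BeltBuckle.graph.IsStationaryVec (BeltBuckle.l x y) p) ∧
      ∀ (m : Measure (Subshift BeltBuckle.graph.adjMat)) (p : BeltBuckle.graph.DirEdge → ℝ),
        Subshift.IsEquilibriumState (-BeltBuckle.graph.edgeFun (BeltBuckle.l x y)) m →
        BeltBuckle.graph.IsStationaryVec (BeltBuckle.l x y) p →
        -- `∂l/∂x` and `∂l/∂y` are tangent vectors at `l(x, y)`
        ⇑(BeltBuckle.graph.edgeFun (BeltBuckle.dlx x y)) ∈ BeltBuckle.graph.tangentSpace m ∧
        ⇑(BeltBuckle.graph.edgeFun (BeltBuckle.dly x y)) ∈ BeltBuckle.graph.tangentSpace m ∧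
        -- the variances, and their polarisation
        (∃ VE VG W : ℝ,
          Subshift.HasVariance (BeltBuckle.graph.edgeFun (BeltBuckle.dlx x y)) m VE ∧
          Subshift.HasVariance (BeltBuckle.graph.edgeFun (BeltBuckle.dly x y)) m VG ∧
          Subshift.HasVariance
            (BeltBuckle.graph.edgeFun (BeltBuckle.dlx x y + BeltBuckle.dly x y)) m W ∧
          VE = 2 * BeltBuckle.Sxx x y * p (2, false) ∧
          VE = BeltBuckle.EP x y ∧
          1 / 2 * (W - VE - VG) = 2 * BeltBuckle.Sxy x y * p (2, false) ∧
          1 / 2 * (W - VE - VG) = BeltBuckle.FP x y ∧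
          VG = 2 * BeltBuckle.Syy x y * p (2, false) ∧
          VG = BeltBuckle.GP x y) ∧
        -- the squared norm of an arbitrary tangent vector `a ∂l/∂x + b ∂l/∂y`
        ∀ a b : ℝ,
          Subshift.HasVariance
            (BeltBuckle.graph.edgeFun (a • BeltBuckle.dlx x y + b • BeltBuckle.dly x y)) m
            (a ^ 2 * BeltBuckle.EP x y + 2 * a * b * BeltBuckle.FP x y +
              b ^ 2 * BeltBuckle.GP x y) := by
  refine ⟨BeltBuckle.bijOn_l, fun x y hq => ?_⟩
  have hxy := BeltBuckle.one_lt_exp_mul_exp hq.1 hq.2.1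
  have h3 : 0 < x + y := add_pos hq.1 hq.2.1
  refine ⟨(BeltBuckle.isPerron (BeltBuckle.sum_l hxy)).existsUnique_isEquilibriumState,
    ⟨_, (BeltBuckle.isStationaryVec_iff (BeltBuckle.sum_l hxy)).2 rfl,
      fun p hp => (BeltBuckle.isStationaryVec_iff (BeltBuckle.sum_l hxy)).1 hp⟩,
    fun m p hm hp => ?_⟩
  have hV := BeltBuckle.hasVariance_tangent hxy hm
  have hp3 : p (2, false) = Real.exp (BeltBuckle.S x y) / (1 + Real.exp (BeltBuckle.S x y)) ^ 2 /
      (2 * ∑ e, Real.exp (BeltBuckle.l x y e) / (1 + Real.exp (BeltBuckle.l x y e)) ^ 2) :=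
    congrFun ((BeltBuckle.isStationaryVec_iff (BeltBuckle.sum_l hxy)).1 hp) (2, false)
  -- The values of the quadratic form at `(1,0)`, `(0,1)` and `(1,1)`; polarisation of the last
  -- leaves `F_P`.
  refine ⟨?_, ?_, ⟨BeltBuckle.EP x y, BeltBuckle.GP x y,
    BeltBuckle.EP x y + 2 * BeltBuckle.FP x y + BeltBuckle.GP x y, ?_, ?_, ?_, ?_, rfl, ?_, ?_,
    ?_, rfl⟩, hV⟩
  · rw [BeltBuckle.dlx_eq h3]
    simpa using BeltBuckle.tangent_mem_tangentSpace hxy hm 1 0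
  · rw [BeltBuckle.dly_eq h3]
    simpa using BeltBuckle.tangent_mem_tangentSpace hxy hm 0 1
  · simpa using hV 1 0
  · simpa using hV 0 1
  · simpa using hV 1 1
  · rw [hp3, BeltBuckle.two_mul_Sxx hxy]
  · rw [hp3, BeltBuckle.two_mul_Sxy hxy]
    ring
  · ring
  · rw [hp3, BeltBuckle.two_mul_Syy hxy]
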